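/- **Setting.** Fix a countable first-order signature; morphisms are homomorphisms. A *Fraïssé class* $\mathcal C$ is a nonempty class of finitely generated structures, closed under isomorphism and under finitely generated substructures, with countably many isomorphism types, with the joint embedding property and the amalgamation property. (Structures may be required to have nonempty carriers, or empty structures may be admitted: what follows holds under either convention.) $\overline{\mathcal C}$ is the class of all countable structures all of whose finitely generated substructures belong to $\mathcal C$, considered as a category with all homomorphisms. The *Fraïssé limit* $\mathrm{Fl}(\mathcal C)$ is the (unique up to isomorphism) countable ultrahomogeneous structure whose finitely generated substructures are, up to isomorphism, exactly the members of $\mathcal C$. A structure $C$ is a *one-point extension* of its substructure $B$ if $C=\langle B\cup\{x\}\rangle$ for some $x\in C\setminus B$; it is *uniquely generated* if there is only one such $x$. - $\mathcal C$ has the *strict AP* if for all embeddings $f:B\to A$, $g:B\to C$ with $A,B,C\in\mathcal C$ there are $P\in\mathcal C$ and embeddings $i_1:A\to P$, $i_2:C\to P$ such that $i_1f=i_2g$ is a pushout square in $\overline{\mathcal C}$. - $\mathcal C$ has the *strict 1PHEP* if for all $B,B',C\in\mathcal C$, every embedding $i:B\to C$ making $C$ a one-point extension of $i(B)$, and every surjective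 homomorphism $f:B\to B'$, the span $C\xleftarrow{\,i\,}B\xrightarrow{\,f\,}B'$ has a pushout in $\overline{\mathcal C}$ that belongs to $\mathcal C$, and in every pushout square $f'i=i'f$ in $\overline{\mathcal C}$ of this span, with $f':C\to P$ and $i':B'\to P$, the map $i'$ is an embedding and $f'$ is surjective. For $A\in\overline{\mathcal C}$, let $(B_i,C_i)_{i\in I}$ be a list of all pairs where $B_i\in\mathcal C$ is a finitely generated substructure of $A$ and $C_i\in\mathcal C$ is a one-point extension of $B_i$, each isomorphism type occurring exactly once (pairs $(B,C)$ and $(B,C')$ are isomorphic if some isomorphism $C\to C'$ fixes $B$ pointwise). The extension $A^\star$ is the free sum of $A$ and the $C_i$ over the $B_i$: a structure $A^\star\in\overline{\mathcal C}$ with embeddings $f:A\to A^\star$ and $g_i:C_i\to A^\star$ such that $f|_{B_i}=g_i|_{B_i}$ for all $i$, and such that for every $D'\in\overline{\mathcal C}$ and all homomorphisms $\varphi:A\to D'$, $\psi_i:C_i\to D'$ with $\varphi|_{B_i}=\psi_i|_{B_i}$ for all $i$ there is a unique homomorphism $\delta:A^\star\to D'$ with $\delta f=\varphi$ and $\delta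 g_i=\psi_i$ for all $i$. **Corollary 2.2.** Let $\mathcal C$ be a Fraïssé class in which every one-point extension $B\subseteq C$ with $B,C\in\mathcal C$ is uniquely generated, and suppose that $\mathcal C$ has the strict AP and the strict 1PHEP. Then $\mathrm{Fl}(\mathcal C)$ exists, and for every $A\in\overline{\mathcal C}$ the extension $A^\star$ exists, and the monoid $\mathrm{End}(A)$ embeds into $\mathrm{End}(A^\star)$ and into $\mathrm{End}(\mathrm{Fl}(\mathcal C))$. Moreover, if the signature has no operation symbols of positive arity (in particular, if it is relational), then one-point extensions are always uniquely generated, so the result covers all relational classes satisfying the other hypotheses. -/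

import Mathlib

open FirstOrder CategoryTheory

universe u v w

namespace FraisseEnd

variable {L : FirstOrder.Language.{u, v}}

/-- The endomorphism monoid of a structure: `φ * ψ` is the composition `φ ∘ ψ` and `1` is the
identity map. -/
instance endMonoid {M : Type w} [L.Structure M] : Monoid (M →[L] M) where
  mul φ ψ := φ.comp ψ
  one := FirstOrder.Language.Hom.id L M
  mul_assoc _ _ _ := rfl
  one_mul _ := rfl
  mul_one _ := rfl

/-- `M` embeds into `N` as a monoid. -/
def MonoidEmbeds (M N : Type*) [Monoid M] [Monoid N] : Prop :=
  ∃ Θ : M →* N, Function.Injective Θ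

/-- A substructure of a bundled structure, as a bundled structure. -/
abbrev sub {M : Bundled.{w} L.Structure} (S : L.Substructure M) : Bundled.{w} L.Structure :=
  ⟨S, inferInstance⟩

/-- Fraïssé classes: nonempty classes of finitely generated structures, closed under isomorphism,
countable up to isomorphism, closed under nonempty finitely generated substructures, with
the joint embedding and the amalgamation property.

Two conventions on empty structures are in use: they are structures like all others (the empty graph
is a graph), or structures have nonempty carriers by definition (metric spaces, for instance). Both
are covered, as `K` may or may not contain empty structures. A class that contains an empty
structure is closed under all finitely generated substructures (by joint embedding), and then
`IsFraisseClass` agrees with `FirstOrder.Language.IsFraisse`. -/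
structure IsFraisseClass (K : Set (Bundled.{w} L.Structure)) : Prop where
  nonempty : K.Nonempty
  fg : ∀ M ∈ K, FirstOrder.Language.Structure.FG L M
  iso_closed : ∀ M ∈ K, ∀ N : Bundled.{w} L.Structure, Nonempty (M ≃[L] N) → N ∈ K
  countable : (Quotient.mk' '' K).Countable
  hereditary : ∀ M ∈ K, ∀ N ∈ L.age M, Nonempty N → N ∈ K
  jointEmbedding : FirstOrder.Language.JointEmbedding K
  amalgamation : FirstOrder.Language.Amalgamation K

/-- The class of all countable structures all of whose finitely generated substructures belong to
`K`. The empty substructure of a nonempty structure is disregarded, so that the definition makes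
sense under both conventions on empty structures; an empty structure is in the class only if
it is in `K`. -/
def Kbar (K : Set (Bundled.{w} L.Structure)) : Set (Bundled.{w} L.Structure) :=
  {M | Countable M ∧ (∀ S : L.Substructure M, S.FG → Nonempty S → sub S ∈ K) ∧
    (IsEmpty M → M ∈ K)}

/-- `F` is a Fraïssé limit of `K`: it is countable, ultrahomogeneous, and its finitely
generated substructures are, up to isomorphism, exactly the members of `K`. -/
structure IsLimit (K : Set (Bundled.{w} L.Structure)) (F : Bundled.{w} L.Structure) : Prop where
  mem_Kbar : F ∈ Kbar K
  universal : ∀ M ∈ K, Nonempty (M ↪[L] F)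
  ultrahomogeneous : L.IsUltrahomogeneous F

/-- The square `i₁ ∘ f = i₂ ∘ g` is a pushout square in the category of all structures in `Kbar K`
with all homomorphisms between them. -/
structure IsPushoutSquare (K : Set (Bundled.{w} L.Structure)) {X Y Z P : Bundled.{w} L.Structure}
    (f : X →[L] Y) (g : X →[L] Z) (i₁ : Y →[L] P) (i₂ : Z →[L] P) : Prop where
  mem_Kbar : P ∈ Kbar K
  comm : i₁.comp f = i₂.comp g
  universal : ∀ Q ∈ Kbar K, ∀ (j₁ : Y →[L] Q) (j₂ : Z →[L] Q), j₁.comp f = j₂.comp g →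
    ∃! t : P →[L] Q, t.comp i₁ = j₁ ∧ t.comp i₂ = j₂

/-- The strict amalgamation property: each amalgam in `K` has a pushout, with respect to `Kbar K`,
that lies in `K` and whose two maps are embeddings. -/
def StrictAP (K : Set (Bundled.{w} L.Structure)) : Prop :=
  ∀ A ∈ K, ∀ B ∈ K, ∀ C ∈ K, ∀ (f : B ↪[L] A) (g : B ↪[L] C),
    ∃ P ∈ K, ∃ (i₁ : A ↪[L] P) (i₂ : C ↪[L] P),
      IsPushoutSquare K f.toHom g.toHom i₁.toHom i₂.toHom

/-- The element `x` generates `C` over the image of `B`, and lies outside of it. -/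
def IsGenerator {B C : Bundled.{w} L.Structure} (e : B ↪[L] C) (x : C) : Prop :=
  x ∉ Set.range e ∧ FirstOrder.Language.Substructure.closure L (Set.range e ∪ {x}) = ⊤

/-- `C` is a one-point extension of (the image under `e` of) `B`. -/
def IsOnePointExt {B C : Bundled.{w} L.Structure} (e : B ↪[L] C) : Prop :=
  ∃ x : C, IsGenerator e x

/-- One-point extensions in `K` are uniquely generated. -/
def UniquelyGenerated (K : Set (Bundled.{w} L.Structure)) : Prop :=
  ∀ B ∈ K, ∀ C ∈ K, ∀ (e : B ↪[L] C) (x x' : C), IsGenerator e x → IsGenerator e x' → x = x'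

/-- The strict one-point homomorphism extension property: for `B, B', C` in `K`, where `C` is a
one-point extension of `B`, and a surjective homomorphism `f : B → B'`, the span `C ← B → B'` has a
pushout, with respect to `Kbar K`, that lies in `K`, and in every such pushout square the map from
`B'` is an embedding and the map from `C` is surjective. -/
def StrictOnePHEP (K : Set (Bundled.{w} L.Structure)) : Prop :=
  ∀ B ∈ K, ∀ B' ∈ K, ∀ C ∈ K, ∀ (i : B ↪[L] C) (f : B →[L] B'),
    IsOnePointExt i → Function.Surjective f →
      (∃ P ∈ K, ∃ (f' : C →[L] P) (i' : B' →[L] P), IsPushoutSquare K i.toHom f f' i') ∧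
      ∀ (P : Bundled.{w} L.Structure) (f' : C →[L] P) (i' : B' →[L] P),
        IsPushoutSquare K i.toHom f f' i' →
          (∃ e : B' ↪[L] P, e.toHom = i') ∧ Function.Surjective f'

/-- A rooted multi-amalgam over `K` with root `A`: a family of finitely generated substructures
`B i` of `A` with `B i ∈ K`, each with an extension `C i ∈ K`, given by an embedding. (So the
`C i` meet `A` and each other only in what they share through the `B i`.) -/
structure RootedMultiAmalgam (K : Set (Bundled.{w} L.Structure)) (A : Bundled.{w} L.Structure) where
  I : Type
  B : I → L.Substructure A
  C : I → Bundled.{w} L.Structure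
  emb : ∀ i, sub (B i) ↪[L] C i
  fg : ∀ i, (B i).FG
  B_mem : ∀ i, sub (B i) ∈ K
  C_mem : ∀ i, C i ∈ K

/-- The rooted multi-amalgam consists of all pairs `(B, C)`, where `B ∈ K` is a finitely generated
substructure of `A` and `C ∈ K` is a one-point extension of `B`, each isomorphism type
being represented exactly once. Pairs `(B, C)` and `(B, C')` are isomorphic if there is an
isomorphism from `C` to `C'` that fixes `B` pointwise. -/
structure RootedMultiAmalgam.IsComplete {K : Set (Bundled.{w} L.Structure)}
    {A : Bundled.{w} L.Structure} (S : RootedMultiAmalgam K A) : Prop where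
  onePoint : ∀ i, IsOnePointExt (S.emb i)
  existsUnique : ∀ B : L.Substructure A, B.FG → sub B ∈ K →
    ∀ C ∈ K, ∀ e : sub B ↪[L] C, IsOnePointExt e →
      ∃! i, ∃ (h : S.B i = B) (ι : S.C i ≃[L] C),
        ∀ b : S.B i, ι (S.emb i b) = e (FirstOrder.Language.Substructure.inclusion h.le b)

/-- `D`, with the embeddings `f : A → D` and `g i : C i → D`, is the free sum over `K` of the
rooted multi-amalgam `S` with root `A`. -/
structure IsFreeSum {K : Set (Bundled.{w} L.Structure)} {A : Bundled.{w} L.Structure}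
    (S : RootedMultiAmalgam K A) {D : Bundled.{w} L.Structure} (f : A ↪[L] D)
    (g : ∀ i, S.C i ↪[L] D) : Prop where
  mem_Kbar : D ∈ Kbar K
  comm : ∀ i (b : S.B i), f b = g i (S.emb i b)
  universal : ∀ D' ∈ Kbar K, ∀ (φ : A →[L] D') (ψ : ∀ i, S.C i →[L] D'),
    (∀ i (b : S.B i), φ b = ψ i (S.emb i b)) →
      ∃! δ : D →[L] D', δ.comp f.toHom = φ ∧ ∀ i, δ.comp (g i).toHom = ψ i

/-- `D` is (a copy of) the extension `A⋆` of `A`: the free sum of the rooted multi-amalgam of all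
one-point extensions in `K` of finitely generated substructures of `A`. -/
def IsStar (K : Set (Bundled.{w} L.Structure)) (A D : Bundled.{w} L.Structure) : Prop :=
  ∃ S : RootedMultiAmalgam K A, S.IsComplete ∧
    ∃ (f : A ↪[L] D) (g : ∀ i, S.C i ↪[L] D), IsFreeSum S f g

end FraisseEnd

namespace FraisseEnd

variable {L : FirstOrder.Language.{u, v}}

open FirstOrder.Language FirstOrder.Language.Substructure

/-! The core is that A⋆ depends functorially on A. Take φ in End(A) and a listed pair (B, C). The
restriction of φ maps B onto B' = φ(B), and the strict 1PHEP pushes C out along B → B' to an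
extension P of B' by at most one point. Either P is B' itself, or it is isomorphic over B' to
exactly one listed extension; in both cases it has a canonical place in A⋆. Unique generation enters
here: it makes a one-point extension rigid over its base, so the map P → A⋆ does not depend on the
chosen isomorphism. The composites C → P → A⋆ agree with f ∘ φ on B, and the universal property of
A⋆ glues them to an endomorphism δ extending φ.

Image factorizations and pushouts are unique up to isomorphism, so δ is determined by φ
(`IsStarMap.unique`). Pushout squares paste, so composites go to composites (`IsStarMap.comp`).
Hence φ ↦ δ is a monoid homomorphism, injective because δ extends φ.

For the existence of A⋆, the strict AP only handles members of K. So A is exhausted by a chain of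
finitely generated substructures, the extensions are glued on one at a time along it, and the union
is taken (`exists_freeSum_nat`).

Iterating A ⊆ A⋆ ⊆ A⋆⋆ ⊆ … gives a union in which every one-point extension of a finitely generated
piece is realized. This union is a Fraïssé limit, and the monoid homomorphisms pass to it.
Uniqueness of the limit carries the result to every limit. -/

/-- Dependent choice along `ℕ`. -/
theorem exists_seq_of_step {α : ℕ → Type*} (R : ∀ n, α n → α (n + 1) → Prop) (x₀ : α 0)
    (h : ∀ n x, ∃ y, R n x y) : ∃ s : ∀ n, α n, s 0 = x₀ ∧ ∀ n, R n (s n) (s (n + 1)) := by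
  choose next hnext using h
  exact ⟨fun n => Nat.rec x₀ (fun n x => next n x) n, rfl, fun n => hnext n _⟩

/-! ### Lifting homomorphisms through embeddings. -/

section Embeddings

variable {X Y A : Type*} [L.Structure X] [L.Structure Y] [L.Structure A]

theorem exists_hom_lift (b : Y ↪[L] A) (g : X →[L] A) (h : ∀ x, ∃ y, b y = g x) :
    ∃ t : X →[L] Y, ∀ x, b (t x) = g x := by
  choose t ht using h
  refine ⟨⟨t, fun {n} F x => b.injective ?_, fun {n} R x hx => ?_⟩, ht⟩
  · rw [ht, g.map_fun, b.map_fun]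
    exact congrArg _ (funext fun i => (ht _).symm)
  · rw [← b.map_rel]
    have : (b ∘ t ∘ x) = g ∘ x := funext fun i => ht _
    rw [this]
    exact g.map_rel R x hx

theorem exists_embedding_lift (b : Y ↪[L] A) (g : X ↪[L] A) (h : ∀ x, ∃ y, b y = g x) :
    ∃ t : X ↪[L] Y, ∀ x, b (t x) = g x := by
  obtain ⟨t, ht⟩ := exists_hom_lift b g.toHom h
  refine ⟨⟨⟨t, fun x y hxy => g.injective ?_⟩, fun F x => t.map_fun F x, fun {n} R x => ?_⟩, ht⟩
  · have := ht x
    rw [hxy, ht y] at this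
    exact this.symm
  · rw [← b.map_rel, ← g.map_rel]
    have : (b ∘ t ∘ x) = g ∘ x := funext fun i => ht _
    exact iff_of_eq (congrArg _ this)

theorem exists_equiv_of_bijective (t : X ↪[L] Y) (h : Function.Surjective t) :
    ∃ θ : X ≃[L] Y, ∀ x, θ x = t x :=
  ⟨⟨Equiv.ofBijective t ⟨t.injective, h⟩, fun F x => t.map_fun F x, fun R x => t.map_rel R x⟩,
    fun _ => rfl⟩

theorem exists_equiv_lift (b : Y ↪[L] A) (g : X ↪[L] A) (h : Set.range g = Set.range b) :
    ∃ θ : X ≃[L] Y, ∀ x, b (θ x) = g x := by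
  obtain ⟨t, ht⟩ := exists_embedding_lift b g fun x => h.subset ⟨x, rfl⟩
  obtain ⟨θ, hθ⟩ := exists_equiv_of_bijective t fun y => by
    obtain ⟨x, hx⟩ := h.symm.subset ⟨y, rfl⟩
    exact ⟨x, b.injective ((ht x).trans hx)⟩
  exact ⟨θ, fun x => by rw [hθ, ht]⟩

theorem exists_equiv_of_inverse (s : X →[L] Y) (t : Y →[L] X) (hst : ∀ y, s (t y) = y)
    (hts : ∀ x, t (s x) = x) : ∃ θ : X ≃[L] Y, ∀ x, θ x = s x := by
  refine ⟨⟨⟨s, t, hts, hst⟩, fun F x => s.map_fun F x, fun {n} R x => ⟨fun h => ?_, s.map_rel R x⟩⟩,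
    fun _ => rfl⟩
  have := t.map_rel R _ h
  have h2 : t ∘ (s ∘ x) = x := funext fun i => hts _
  exact h2 ▸ this

end Embeddings

/-- Constants already lie in the range of `e`, so adding the single point `x` to it gives a
substructure. It must be everything, which leaves no room for a second generator. -/
theorem uniquelyGenerated_of_isEmpty_functions (K : Set (Bundled.{w} L.Structure))
    (hL : ∀ n : ℕ, IsEmpty (L.Functions (n + 1))) : UniquelyGenerated K := by
  intro B _ C _ e x x' hx hx'
  let S : L.Substructure C := 
    { carrier := Set.range e ∪ {x}
      fun_mem := fun {n} F y _ => by
        cases n with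
        | zero =>
          refine Or.inl ⟨Structure.funMap F default, ?_⟩
          rw [e.map_fun]
          exact congrArg _ (Subsingleton.elim _ _)
        | succ n => exact (hL n).elim F }
  have hS : closure L (Set.range e ∪ {x}) ≤ S := closure_le.2 fun _ h => h
  rw [hx.2] at hS
  rcases hS (show x' ∈ ⊤ from trivial) with h | h
  · exact (hx'.1 h).elim
  · exact h.symm

/-! ### Unions of countable chains of embeddings. -/

section Chains

variable {G : ℕ → Bundled.{w} L.Structure} {s : ∀ n, G n ↪[L] G (n + 1)}
  {F : Bundled.{w} L.Structure} {c : ∀ n, G n ↪[L] F}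

/-- `F`, with the embeddings `c n`, is the union of the chain of structures `G n`. -/
structure IsChainUnion (s : ∀ n, G n ↪[L] G (n + 1)) (c : ∀ n, G n ↪[L] F) : Prop where
  comm : ∀ n x, c (n + 1) (s n x) = c n x
  cover : ∀ y, ∃ n x, c n x = y

theorem exists_isChainUnion (s : ∀ n, G n ↪[L] G (n + 1)) :
    ∃ (F : Bundled.{w} L.Structure) (c : ∀ n, G n ↪[L] F), IsChainUnion s c := by
  let f : ∀ i j, i ≤ j → G i ↪[L] G j := fun i j h => DirectedSystem.natLERec s i j h
  refine ⟨⟨FirstOrder.Language.DirectLimit (fun n => G n) f, inferInstance⟩,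
    fun n => FirstOrder.Language.DirectLimit.of L ℕ (fun n => G n) f n, fun n x => ?_,
    fun y => FirstOrder.Language.DirectLimit.exists_of y⟩
  have := FirstOrder.Language.DirectLimit.of_f (L := L) (G := fun n => G n) (f := f) (hij := Nat.le_succ n) (x := x)
  rw [← this]
  congr 1
  change _ = (DirectedSystem.natLERec s n (n + 1) (Nat.le_succ n) : G n → G (n + 1)) x
  rw [DirectedSystem.coe_natLERec]
  exact (Nat.leRecOn_succ' (C := fun n => G n) (next := fun {k} => s k) x).symm

namespace IsChainUnion

variable (hc : IsChainUnion s c)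
include hc

theorem exists_le {n : ℕ} (x : G n) {m : ℕ} (h : n ≤ m) : ∃ y : G m, c m y = c n x := by
  induction m, h using Nat.le_induction with
  | base => exact ⟨x, rfl⟩
  | succ m _ ih =>
    obtain ⟨y, hy⟩ := ih
    exact ⟨s m y, by rw [hc.comm, hy]⟩

theorem exists_of_finite {ι : Type*} [Finite ι] (y : ι → F) :
    ∃ n, ∃ x : ι → G n, ∀ i, c n (x i) = y i := by
  choose n x hx using fun i => hc.cover (y i)
  obtain ⟨m, hm⟩ := Finite.bddAbove_range n
  choose z hz using fun i => hc.exists_le (x i) (hm ⟨i, rfl⟩)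
  exact ⟨m, z, fun i => by rw [hz, hx]⟩

theorem exists_range_le {S : L.Substructure F} (hS : S.FG) :
    ∃ n, ∀ y ∈ S, ∃ x, c n x = y := by
  obtain ⟨T, rfl⟩ := hS
  obtain ⟨n, x, hx⟩ := hc.exists_of_finite (fun i : T => (i : F))
  refine ⟨n, ?_⟩
  have : closure L (T : Set F) ≤ (c n).toHom.range :=
    closure_le.2 fun i hi => ⟨x ⟨i, hi⟩, hx ⟨i, hi⟩⟩
  intro y hy
  obtain ⟨x, hx⟩ := Hom.mem_range.1 (this hy)
  exact ⟨x, hx⟩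

theorem hom_ext {Q : Type*} [L.Structure Q] {t t' : F →[L] Q}
    (h : ∀ n x, t (c n x) = t' (c n x)) : t = t' := by
  ext y
  obtain ⟨n, x, rfl⟩ := hc.cover y
  exact h n x

/-- Comparing two representatives at the later stage shows that the value depends only on the
element of `F`. Operations and relations involve finitely many elements, so they can be checked
inside one stage. -/
theorem exists_hom {Q : Type*} [L.Structure Q] (ψ : ∀ n, G n →[L] Q)
    (h : ∀ n x, ψ (n + 1) (s n x) = ψ n x) :
    ∃ t : F →[L] Q, ∀ n x, t (c n x) = ψ n x := by
  have mono : ∀ {n m : ℕ}, n ≤ m → ∀ (x : G n) (y : G m), c m y = c n x → ψ m y = ψ n x := by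
    intro n m hnm
    induction m, hnm using Nat.le_induction with
    | base => exact fun x y hxy => by rw [(c n).injective hxy]
    | succ m hm ih =>
      intro x y hxy
      obtain ⟨z, hz⟩ := hc.exists_le x hm
      have : y = s m z := (c (m + 1)).injective (by rw [hxy, hc.comm, hz])
      rw [this, h, ih x z hz]
  have key : ∀ {n m : ℕ} (x : G n) (y : G m), c m y = c n x → ψ m y = ψ n x := by
    intro n m x y hxy
    rcases le_total n m with hnm | hnm
    · exact mono hnm x y hxy
    · exact (mono hnm y x hxy.symm).symm
  choose n x hx using hc.cover
  refine ⟨⟨fun y => ψ (n y) (x y), fun {k} f y => ?_, fun {k} R y hy => ?_⟩,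
    fun m z => key _ _ (hx _)⟩
  · obtain ⟨m, z, hz⟩ := hc.exists_of_finite y
    have h1 : ∀ i, ψ (n (y i)) (x (y i)) = ψ m (z i) := fun i =>
      key _ _ ((hx (y i)).trans (hz i).symm)
    have h2 : c m (Structure.funMap f z) = Structure.funMap f y := by
      rw [(c m).map_fun]
      exact congrArg _ (funext hz)
    rw [key (Structure.funMap f z) _ ((hx _).trans h2.symm), (ψ m).map_fun]
    exact congrArg _ (funext fun i => (h1 i).symm)
  · obtain ⟨m, z, hz⟩ := hc.exists_of_finite y
    have h1 : ∀ i, ψ (n (y i)) (x (y i)) = ψ m (z i) := fun i =>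
      key _ _ ((hx (y i)).trans (hz i).symm)
    have h2 : y = c m ∘ z := funext fun i => (hz i).symm
    have h3 : (fun y => ψ (n y) (x y)) ∘ y = ψ m ∘ z := funext h1
    change Structure.RelMap R ((fun y => ψ (n y) (x y)) ∘ y)
    rw [h3]
    refine (ψ m).map_rel R z ?_
    rw [h2, (c m).map_rel] at hy
    exact hy

theorem exists_embedding {Q : Type*} [L.Structure Q] (ψ : ∀ n, G n ↪[L] Q)
    (h : ∀ n x, ψ (n + 1) (s n x) = ψ n x) :
    ∃ t : F ↪[L] Q, ∀ n x, t (c n x) = ψ n x := by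
  obtain ⟨t, ht⟩ := hc.exists_hom (fun n => (ψ n).toHom) h
  change ∀ n x, t (c n x) = ψ n x at ht
  refine ⟨⟨⟨t, fun y y' hy => ?_⟩, fun f x => t.map_fun f x, fun {k} R y => ?_⟩, ht⟩
  · obtain ⟨m, z, hz⟩ := hc.exists_of_finite ![y, y']
    have h0 : c m (z 0) = y := hz 0
    have h1 : c m (z 1) = y' := hz 1
    rw [← h0, ← h1, ht, ht] at hy
    rw [← h0, ← h1, (ψ m).injective hy]
  · obtain ⟨m, z, hz⟩ := hc.exists_of_finite y
    have h2 : y = c m ∘ z := funext fun i => (hz i).symm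
    have h3 : t ∘ y = ψ m ∘ z := by
      rw [h2]
      exact funext fun i => ht m _
    change Structure.RelMap R (t ∘ y) ↔ _
    rw [h3, h2, (c m).map_rel, (ψ m).map_rel]

end IsChainUnion

end Chains

/-! ### Membership in the class and its closure, with care for empty structures. -/

section Membership

variable {K : Set (Bundled.{w} L.Structure)}

theorem IsFraisseClass.mem_of_mem_Kbar (hK : IsFraisseClass K) {M N : Bundled.{w} L.Structure}
    (hM : M ∈ Kbar K) (e : N ↪[L] M) (hN : Structure.FG L N) [Nonempty N] : N ∈ K :=
  hK.iso_closed _ (hM.2.1 e.toHom.range (hN.range _) ⟨e.equivRange (Classical.arbitrary N)⟩) _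
    ⟨e.equivRange.symm⟩

theorem IsFraisseClass.mem_of_surjective (hK : IsFraisseClass K) {M N : Bundled.{w} L.Structure}
    (hM : M ∈ K) (e : M ↪[L] N) (he : Function.Surjective e) : N ∈ K :=
  hK.iso_closed _ hM _ ⟨(exists_equiv_of_bijective e he).choose⟩

/-- Covers an empty `N`, about which `Kbar` says nothing: then `E` is empty too, and `i` is an
isomorphism. -/
theorem IsFraisseClass.mem_of_between (hK : IsFraisseClass K) {E M N : Bundled.{w} L.Structure}
    (hE : E ∈ K) (i : E ↪[L] N) (hM : M ∈ Kbar K) (e : N ↪[L] M) (hN : Structure.FG L N) :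
    N ∈ K := by
  cases isEmpty_or_nonempty N
  · exact hK.mem_of_surjective hE i fun y => isEmptyElim y
  · exact hK.mem_of_mem_Kbar hM e hN

theorem IsFraisseClass.mem_Kbar [Countable (Σ l, L.Functions l)] (hK : IsFraisseClass K)
    {M : Bundled.{w} L.Structure} (hM : M ∈ K) : M ∈ Kbar K :=
  ⟨Structure.cg_iff_countable.1 (hK.fg M hM).cg, fun S hS hne =>
    hK.hereditary M hM _ ⟨(fg_iff_structure_fg S).1 hS, ⟨S.subtype⟩⟩ hne, fun _ => hM⟩

/-- A starting point for exhaustions. The bottom substructure will not do, since it may be empty and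
empty structures need not be in `K`. -/
theorem exists_fg_mem {A : Bundled.{w} L.Structure} (hK : IsFraisseClass K) (hA : A ∈ Kbar K) :
    ∃ S : L.Substructure A, S.FG ∧ sub S ∈ K := by
  cases isEmpty_or_nonempty A with
  | inl h =>
    have := hA.2.2 h
    exact ⟨⊤, Structure.fg_def.1 (hK.fg _ this), hK.iso_closed _ this _ ⟨topEquiv.symm⟩⟩
  | inr h =>
    obtain ⟨a⟩ := h
    exact ⟨closure L {a}, fg_closure_singleton a, hA.2.1 _ (fg_closure_singleton a)
      ⟨⟨a, subset_closure rfl⟩⟩⟩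

theorem IsFraisseClass.sub_mem_of_le (hK : IsFraisseClass K) {A : Bundled.{w} L.Structure}
    (hA : A ∈ Kbar K) {S T : L.Substructure A} (hS : sub S ∈ K) (hST : S ≤ T) (hT : T.FG) :
    sub T ∈ K :=
  hK.mem_of_between hS (Substructure.inclusion hST) hA T.subtype ((fg_iff_structure_fg T).1 hT)

theorem IsChainUnion.mem_Kbar (hK : IsFraisseClass K)
    {G : ℕ → Bundled.{w} L.Structure} {s : ∀ n, G n ↪[L] G (n + 1)}
    {F : Bundled.{w} L.Structure} {c : ∀ n, G n ↪[L] F} (hc : IsChainUnion s c)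
    (hG : ∀ n, G n ∈ Kbar K) : F ∈ Kbar K := by
  refine ⟨?_, fun S hS hne => ?_, fun hF => ?_⟩
  · have := fun n => (hG n).1
    have h : Function.Surjective (fun x : Σ n, G n => c x.1 x.2) := fun y => by
      obtain ⟨n, x, h⟩ := hc.cover y
      exact ⟨⟨n, x⟩, h⟩
    exact h.countable
  · obtain ⟨n, hn⟩ := hc.exists_range_le hS
    obtain ⟨t, -⟩ := exists_embedding_lift (c n) S.subtype fun x => hn x x.2
    exact hK.mem_of_mem_Kbar (N := sub S) (hG n) t ((fg_iff_structure_fg S).1 hS)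
  · have : IsEmpty (G 0) := (c 0).toFun.isEmpty
    exact hK.mem_of_surjective ((hG 0).2.2 this) (c 0) fun y => isEmptyElim y

end Membership

/-! ### Free sums of countable families, from the strict amalgamation property. -/

section FreeSums

variable {K : Set (Bundled.{w} L.Structure)}

theorem IsPushoutSquare.exists_hom {X Y Z P Q : Bundled.{w} L.Structure}
    {f : X →[L] Y} {g : X →[L] Z} {i₁ : Y →[L] P} {i₂ : Z →[L] P}
    (h : IsPushoutSquare K f g i₁ i₂) (hQ : Q ∈ Kbar K) (j₁ : Y →[L] Q) (j₂ : Z →[L] Q)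
    (hj : ∀ x, j₁ (f x) = j₂ (g x)) :
    ∃ t : P →[L] Q, (∀ y, t (i₁ y) = j₁ y) ∧ ∀ z, t (i₂ z) = j₂ z := by
  obtain ⟨t, ⟨h1, h2⟩, -⟩ := h.universal Q hQ j₁ j₂ (DFunLike.ext _ _ hj)
  exact ⟨t, DFunLike.congr_fun h1, DFunLike.congr_fun h2⟩

theorem IsPushoutSquare.comm_apply {X Y Z P : Bundled.{w} L.Structure}
    {f : X →[L] Y} {g : X →[L] Z} {i₁ : Y →[L] P} {i₂ : Z →[L] P}
    (h : IsPushoutSquare K f g i₁ i₂) (x : X) : i₁ (f x) = i₂ (g x) :=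
  DFunLike.congr_fun h.comm x

theorem IsPushoutSquare.hom_ext {X Y Z P Q : Bundled.{w} L.Structure}
    {f : X →[L] Y} {g : X →[L] Z} {i₁ : Y →[L] P} {i₂ : Z →[L] P}
    (h : IsPushoutSquare K f g i₁ i₂) (hQ : Q ∈ Kbar K) {t t' : P →[L] Q}
    (h₁ : ∀ y, t (i₁ y) = t' (i₁ y)) (h₂ : ∀ z, t (i₂ z) = t' (i₂ z)) : t = t' := by
  refine (h.universal Q hQ (t'.comp i₁) (t'.comp i₂) ?_).unique
    ⟨DFunLike.ext _ _ h₁, DFunLike.ext _ _ h₂⟩ ⟨rfl, rfl⟩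
  exact DFunLike.ext _ _ fun x => congrArg t' (h.comm_apply x)

theorem isPushoutSquare_of {X Y Z P : Bundled.{w} L.Structure}
    {f : X →[L] Y} {g : X →[L] Z} {i₁ : Y →[L] P} {i₂ : Z →[L] P} (hP : P ∈ Kbar K)
    (hcomm : ∀ x, i₁ (f x) = i₂ (g x))
    (hex : ∀ Q ∈ Kbar K, ∀ (j₁ : Y →[L] Q) (j₂ : Z →[L] Q), (∀ x, j₁ (f x) = j₂ (g x)) →
      ∃ t : P →[L] Q, (∀ y, t (i₁ y) = j₁ y) ∧ ∀ z, t (i₂ z) = j₂ z)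
    (huniq : ∀ Q ∈ Kbar K, ∀ t t' : P →[L] Q, (∀ y, t (i₁ y) = t' (i₁ y)) →
      (∀ z, t (i₂ z) = t' (i₂ z)) → t = t') : IsPushoutSquare K f g i₁ i₂ := by
  refine ⟨hP, DFunLike.ext _ _ hcomm, fun Q hQ j₁ j₂ hj => ?_⟩
  obtain ⟨t, h1, h2⟩ := hex Q hQ j₁ j₂ (DFunLike.congr_fun hj)
  refine ⟨t, ⟨DFunLike.ext _ _ h1, DFunLike.ext _ _ h2⟩, fun t' ht' => huniq Q hQ _ _ ?_ ?_⟩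
  · exact fun y => (DFunLike.congr_fun ht'.1 y).trans (h1 y).symm
  · exact fun z => (DFunLike.congr_fun ht'.2 z).trans (h2 z).symm

/-- Amalgamating `P` with `Y` over `X`, and then with `C` over a substructure `B` of `Y`. -/
theorem StrictAP.exists_amalgam (hAP : StrictAP K) {P X Y B C : Bundled.{w} L.Structure} (hP : P ∈ K) (hX : X ∈ K) (hY : Y ∈ K)
    (hB : B ∈ K) (hC : C ∈ K) (a : X ↪[L] P) (x : X ↪[L] Y) (b : B ↪[L] Y) (e : B ↪[L] C) :
    ∃ R ∈ K, ∃ (p : P ↪[L] R) (a' : Y ↪[L] R) (c : C ↪[L] R),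
      (∀ z, p (a z) = a' (x z)) ∧ (∀ z, a' (b z) = c (e z)) ∧
      (∀ Q ∈ Kbar K, ∀ (t : P →[L] Q) (φ : Y →[L] Q) (ψ : C →[L] Q),
        (∀ z, t (a z) = φ (x z)) → (∀ z, φ (b z) = ψ (e z)) →
        ∃ t' : R →[L] Q, (∀ z, t' (p z) = t z) ∧ (∀ z, t' (a' z) = φ z) ∧ ∀ z, t' (c z) = ψ z) ∧
      (∀ Q ∈ Kbar K, ∀ t t' : R →[L] Q, (∀ z, t (p z) = t' (p z)) → (∀ z, t (a' z) = t' (a' z)) →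
        (∀ z, t (c z) = t' (c z)) → t = t') := by
  obtain ⟨P₁, hP₁, p₁, y₁, h₁⟩ := hAP P hP X hX Y hY a x
  obtain ⟨R, hR, p₂, c₂, h₂⟩ := hAP P₁ hP₁ B hB C hC (y₁.comp b) e
  refine ⟨R, hR, p₂.comp p₁, p₂.comp y₁, c₂, fun z => congrArg p₂ (h₁.comm_apply z),
    h₂.comm_apply, ?_, ?_⟩
  · intro Q hQ t φ ψ htφ hφψ
    obtain ⟨t₁, ht₁, ht₁'⟩ := h₁.exists_hom hQ t φ htφ
    obtain ⟨t₂, ht₂, ht₂'⟩ := h₂.exists_hom hQ t₁ ψ fun z => (ht₁' _).trans (hφψ z)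
    exact ⟨t₂, fun z => (ht₂ _).trans (ht₁ z), fun z => (ht₂ _).trans (ht₁' z), ht₂'⟩
  · intro Q hQ t t' hp hy hc
    have : t.comp p₂.toHom = t'.comp p₂.toHom := h₁.hom_ext hQ hp hy
    exact h₂.hom_ext hQ (DFunLike.congr_fun this) hc

/-- A countable structure in `Kbar K` is the union of a chain of finitely generated
substructures, whose successive steps contain prescribed finitely generated substructures. -/
theorem exists_exhaustion (hK : IsFraisseClass K) {A : Bundled.{w} L.Structure} (hA : A ∈ Kbar K)
    (T : ℕ → L.Substructure A) (hT : ∀ n, (T n).FG) :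
    ∃ S : ℕ → L.Substructure A, (∀ n, sub (S n) ∈ K) ∧ (∀ n, S n ≤ S (n + 1)) ∧
      (∀ n, T n ≤ S (n + 1)) ∧ ∀ a, ∃ n, a ∈ S n := by
  have := hA.1
  obtain ⟨S₀, hS₀, hS₀K⟩ := exists_fg_mem hK hA
  obtain ⟨V, hV⟩ := exists_surjective_nat {S : L.Substructure A // S.FG}
  let S : ℕ → L.Substructure A := fun n => Nat.rec S₀ (fun n S => S ⊔ T n ⊔ (V n).1) n
  have hle : ∀ n, S n ≤ S (n + 1) := fun n => le_sup_left.trans le_sup_left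
  have hfg : ∀ n, (S n).FG := fun n => by
    induction n with
    | zero => exact hS₀
    | succ n ih => exact (ih.sup (hT n)).sup (V n).2
  refine ⟨S, fun n => hK.sub_mem_of_le hA hS₀K (monotone_nat_of_le_succ hle n.zero_le) (hfg n),
    hle, fun n => le_sup_right.trans le_sup_left, fun a => ?_⟩
  obtain ⟨n, hn⟩ := hV ⟨closure L {a}, fg_closure_singleton a⟩
  refine ⟨n + 1, (le_sup_right : (V n).1 ≤ S (n + 1)) ?_⟩
  rw [hn]
  exact subset_closure rfl

theorem exists_freeSum_nat [Countable (Σ l, L.Functions l)] (hK : IsFraisseClass K)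
    (hAP : StrictAP K) {A : Bundled.{w} L.Structure} (hA : A ∈ Kbar K)
    {B C : ℕ → Bundled.{w} L.Structure} (hB : ∀ n, B n ∈ K) (hC : ∀ n, C n ∈ K)
    (b : ∀ n, B n ↪[L] A) (e : ∀ n, B n ↪[L] C n) :
    ∃ D ∈ Kbar K, ∃ (f : A ↪[L] D) (g : ∀ n, C n ↪[L] D),
      (∀ n z, f (b n z) = g n (e n z)) ∧
      (∀ Q ∈ Kbar K, ∀ (φ : A →[L] Q) (ψ : ∀ n, C n →[L] Q), (∀ n z, φ (b n z) = ψ n (e n z)) →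
        ∃ t : D →[L] Q, (∀ z, t (f z) = φ z) ∧ ∀ n z, t (g n z) = ψ n z) ∧
      (∀ Q ∈ Kbar K, ∀ t t' : D →[L] Q, (∀ z, t (f z) = t' (f z)) →
        (∀ n z, t (g n z) = t' (g n z)) → t = t') := by
  obtain ⟨S, hSK, hS, hbS, hcover⟩ := exists_exhaustion hK hA (fun n => (b n).toHom.range)
    fun n => (hK.fg _ (hB n)).range _
  choose β hβ using fun n => exists_embedding_lift (S (n + 1)).subtype (b n)
    fun z => ⟨⟨b n z, hbS n ⟨z, rfl⟩⟩, rfl⟩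
  have hSA : IsChainUnion (G := fun n => sub (S n)) (fun n => Substructure.inclusion (hS n))
      (fun n => (S n).subtype) :=
    ⟨fun n x => rfl, fun a => (hcover a).imp fun n hn => ⟨⟨a, hn⟩, rfl⟩⟩
  -- Stage `n` is a structure `P n` in `K` with a copy of `S n`; the next one freely adds `S (n +
  -- 1)` over `S n`, then `C n` over `B n`. The relation keeps the existence and uniqueness halves
  -- of the universal property of this step.
  obtain ⟨s, hs₀, hs⟩ := exists_seq_of_step
    (α := fun n => {P : Σ P : Bundled.{w} L.Structure, sub (S n) ↪[L] P // P.1 ∈ K})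
    (fun n P P' => ∃ (p : P.1.1 ↪[L] P'.1.1) (c : C n ↪[L] P'.1.1),
      (∀ z, p (P.1.2 z) = P'.1.2 (Substructure.inclusion (hS n) z)) ∧
      (∀ z, P'.1.2 (β n z) = c (e n z)) ∧
      (∀ Q ∈ Kbar K, ∀ (t : P.1.1 →[L] Q) (φ : sub (S (n + 1)) →[L] Q) (ψ : C n →[L] Q),
        (∀ z, t (P.1.2 z) = φ (Substructure.inclusion (hS n) z)) →
        (∀ z, φ (β n z) = ψ (e n z)) →
        ∃ t' : P'.1.1 →[L] Q,
          (∀ z, t' (p z) = t z) ∧ (∀ z, t' (P'.1.2 z) = φ z) ∧ ∀ z, t' (c z) = ψ z) ∧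
      (∀ Q ∈ Kbar K, ∀ t t' : P'.1.1 →[L] Q, (∀ z, t (p z) = t' (p z)) →
        (∀ z, t (P'.1.2 z) = t' (P'.1.2 z)) → (∀ z, t (c z) = t' (c z)) → t = t'))
    ⟨⟨sub (S 0), Embedding.refl L _⟩, hSK 0⟩ (fun n P => by
      obtain ⟨R, hR, p, a', c, h⟩ := hAP.exists_amalgam P.2 (hSK n) (hSK (n + 1)) (hB n) (hC n)
        P.1.2 (Substructure.inclusion (hS n)) (β n) (e n)
      exact ⟨⟨⟨R, a'⟩, hR⟩, p, c, h⟩)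
  choose p c hpa hac hex huniq using hs
  -- All that is needed about the initial stage: `P 0` is a copy of `S 0`, so maps out of it are
  -- determined by `φ`.
  have ha₀ : Function.Surjective (s 0).1.2 := by
    rw [hs₀]
    exact fun y => ⟨y, rfl⟩
  clear hs₀
  let P : ℕ → Bundled.{w} L.Structure := fun n => (s n).1.1
  have hPK : ∀ n, P n ∈ K := fun n => (s n).2
  let a : ∀ n, sub (S n) ↪[L] P n := fun n => (s n).1.2
  obtain ⟨D, d, hd⟩ := exists_isChainUnion (G := P) p
  have hDK : D ∈ Kbar K := hd.mem_Kbar hK fun n => hK.mem_Kbar (hPK n)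
  obtain ⟨f, hf⟩ := hSA.exists_embedding (fun n => (d n).comp (a n)) fun n x => by
    change d (n + 1) (a (n + 1) _) = d n (a n x)
    exact (congrArg _ (hpa n x).symm).trans (hd.comm n _)
  change ∀ n (x : sub (S n)), f x = d n (a n x) at hf
  refine ⟨D, hDK, f, fun n => (d (n + 1)).comp (c n), fun n z => ?_, ?_, ?_⟩
  · rw [← hβ]
    exact (hf (n + 1) _).trans (congrArg (d (n + 1)) (hac n z))
  · intro Q hQ φ ψ hφψ
    let φ' : ∀ n, sub (S n) →[L] Q := fun n => φ.comp (S n).subtype.toHom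
    obtain ⟨θ₀, hθ₀⟩ := exists_equiv_of_bijective (a 0) ha₀
    obtain ⟨t, -, ht⟩ := exists_seq_of_step
      (α := fun n => {t : P n →[L] Q // ∀ z, t (a n z) = φ' n z})
      (fun n t t' => (∀ z, t'.1 (p n z) = t.1 z) ∧ ∀ z, t'.1 (c n z) = ψ n z)
      ⟨(φ' 0).comp θ₀.symm.toHom, fun z => by
        change φ' 0 (θ₀.symm (a 0 z)) = _
        rw [← hθ₀]
        exact congrArg _ (FirstOrder.Language.Equiv.symm_apply_apply θ₀ z)⟩
      (fun n t => by
        obtain ⟨t', h1, h2, h3⟩ := hex n Q hQ t.1 (φ' (n + 1)) (ψ n) t.2 fun z => by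
          rw [← hφψ, ← hβ]
          rfl
        exact ⟨⟨t', h2⟩, h1, h3⟩)
    obtain ⟨T, hT⟩ := hd.exists_hom (fun n => (t n).1) fun n => (ht n).1
    refine ⟨T, fun z => ?_, fun n z => (hT _ _).trans ((ht n).2 z)⟩
    obtain ⟨n, hn⟩ := hcover z
    rw [show z = (S n).subtype ⟨z, hn⟩ from rfl]
    exact (congrArg T (hf n ⟨z, hn⟩)).trans ((hT _ _).trans ((t n).2 _))
  -- Uniqueness propagates from stage to stage, starting from `P 0`, where everything comes from
  -- `A`.
  · intro Q hQ t t' htf htg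
    have hta : ∀ n z, t (d n (a n z)) = t' (d n (a n z)) := fun n z => by
      rw [← hf]
      exact htf _
    have key : ∀ n, t.comp (d n).toHom = t'.comp (d n).toHom := fun n => by
      induction n with
      | zero =>
        refine DFunLike.ext _ _ fun y => ?_
        obtain ⟨z, rfl⟩ := ha₀ y
        exact hta 0 z
      | succ n ih =>
        refine huniq n Q hQ _ _ (fun z => ?_) (hta (n + 1)) (htg n)
        have := DFunLike.congr_fun ih z
        change t (d (n + 1) (p n z)) = t' (d (n + 1) (p n z))
        rw [hd.comm]
        exact this
    exact hd.hom_ext fun n => DFunLike.congr_fun (key n)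

end FreeSums

/-! ### Existence of the extension A⋆. -/

section Star

variable {K : Set (Bundled.{w} L.Structure)}

theorem RootedMultiAmalgam.exists_isFreeSum [Countable (Σ l, L.Functions l)]
    (hK : IsFraisseClass K) (hAP : StrictAP K) {A : Bundled.{w} L.Structure} (hA : A ∈ Kbar K)
    (S : RootedMultiAmalgam K A) [Countable S.I] :
    ∃ (D : Bundled.{w} L.Structure) (f : A ↪[L] D) (g : ∀ i, S.C i ↪[L] D), IsFreeSum S f g := by
  have := Encodable.ofCountable S.I
  obtain ⟨S₀, -, hS₀⟩ := exists_fg_mem hK hA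
  let B : Option S.I → Bundled.{w} L.Structure := fun j => j.elim (sub S₀) fun i => sub (S.B i)
  let C : Option S.I → Bundled.{w} L.Structure := fun j => j.elim (sub S₀) S.C
  let b : ∀ j, B j ↪[L] A := fun j => match j with
    | none => S₀.subtype
    | some i => (S.B i).subtype
  let e : ∀ j, B j ↪[L] C j := fun j => match j with
    | none => Embedding.refl L _
    | some i => S.emb i
  have hB : ∀ j, B j ∈ K := fun j => match j with
    | none => hS₀
    | some i => S.B_mem i
  have hC : ∀ j, C j ∈ K := fun j => match j with
    | none => hS₀
    | some i => S.C_mem i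
  have he : ∀ j, j = none → Function.Surjective (e j) := by
    rintro _ rfl
    exact fun y => ⟨y, rfl⟩
  -- With `decode₂` each index is hit exactly once, so no `C i` is glued on twice. The remaining
  -- numbers get the trivial pair `(S₀, S₀)`, which adds nothing.
  let x : ℕ → Option S.I := Encodable.decode₂ S.I
  obtain ⟨D, hD, f, g, hfg, hex, huniq⟩ := exists_freeSum_nat hK hAP hA
    (fun n => hB (x n)) (fun n => hC (x n)) (fun n => b (x n)) (fun n => e (x n))
  -- Stated for a variable `j` equal to `x n`, so that the dependent types change by substitution
  -- instead of casts.
  have hx : ∀ n j, x n = j → ∃ g' : C j ↪[L] D, (∀ z, f (b j z) = g' (e j z)) ∧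
      (∀ (Q : Bundled.{w} L.Structure) (t : D →[L] Q) (ψ : ∀ j, C j →[L] Q),
        (∀ n z, t (g n z) = ψ (x n) z) → ∀ z, t (g' z) = ψ j z) ∧
      ∀ (Q : Bundled.{w} L.Structure) (t t' : D →[L] Q), (∀ z, t (g' z) = t' (g' z)) →
        ∀ z, t (g n z) = t' (g n z) := by
    rintro n _ rfl
    exact ⟨g n, hfg n, fun Q t ψ h => h n, fun Q t t' h => h⟩
  have hx' : ∀ i, x (Encodable.encode i) = some i := fun i => Encodable.decode₂_encode i
  choose g' hg'₁ hg'₂ hg'₃ using fun i : S.I => hx (Encodable.encode i) (some i) (hx' i)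
  refine ⟨D, f, g', hD, hg'₁, fun Q hQ φ ψ hφψ => ?_⟩
  let ψ' : ∀ j, C j →[L] Q := fun j => match j with
    | none => φ.comp S₀.subtype.toHom
    | some i => ψ i
  have hψ' : ∀ j z, φ (b j z) = ψ' j (e j z) := fun j => match j with
    | none => fun z => rfl
    | some i => hφψ i
  obtain ⟨t, htf, htg⟩ := hex Q hQ φ (fun n => ψ' (x n)) fun n => hψ' (x n)
  refine ⟨t, ⟨DFunLike.ext _ _ htf, fun i => DFunLike.ext _ _ (hg'₂ i Q t ψ' htg)⟩, ?_⟩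
  rintro t' ⟨ht'f, ht'g⟩
  have hf' : ∀ z, t' (f z) = t (f z) := fun z => (DFunLike.congr_fun ht'f z).trans (htf z).symm
  refine huniq Q hQ t' t hf' fun n => ?_
  rcases Option.eq_none_or_eq_some (x n) with hn | ⟨i, hn⟩
  · intro z
    obtain ⟨z, rfl⟩ := he _ hn z
    have := hf' (b (x n) z)
    rwa [hfg n z] at this
  · obtain rfl : Encodable.encode i = n := Encodable.mem_decode₂.1 hn
    refine hg'₃ i Q t' t fun z => ?_
    exact (DFunLike.congr_fun (ht'g i) z).trans (hg'₂ i Q t ψ' htg z).symm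

theorem IsGenerator.of_equiv {B C B' C' : Bundled.{w} L.Structure} {e : B ↪[L] C} {x : C}
    (h : IsGenerator e x) (θ : C ≃[L] C') {e' : B' ↪[L] C'}
    (he' : Set.range e' = θ '' Set.range e) : IsGenerator e' (θ x) := by
  refine ⟨fun hx => ?_, ?_⟩
  · rw [he'] at hx
    obtain ⟨y, hy, hyx⟩ := hx
    exact h.1 (θ.injective hyx ▸ hy)
  · have h1 : Set.range e' ∪ {θ x} = θ.toHom '' (Set.range e ∪ {x}) := by
      rw [Set.image_union, Set.image_singleton, he']
      rfl
    rw [h1, closure_image, h.2, ← Hom.range_eq_map]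
    exact Equiv.toHom_range θ

theorem IsOnePointExt.of_equiv {B C B' C' : Bundled.{w} L.Structure} {e : B ↪[L] C}
    (h : IsOnePointExt e) (θ : C ≃[L] C') {e' : B' ↪[L] C'}
    (he' : Set.range e' = θ '' Set.range e) : IsOnePointExt e' :=
  h.imp' θ fun _ hx => hx.of_equiv θ he'

theorem IsFraisseClass.exists_representatives (hK : IsFraisseClass K) :
    ∃ M : ℕ → Bundled.{w} L.Structure, (∀ n, M n ∈ K) ∧ ∀ C ∈ K, ∃ n, Nonempty (C ≃[L] M n) := by
  obtain ⟨q, hq⟩ := hK.countable.exists_eq_range (hK.nonempty.image _)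
  choose M hM hMq using fun n => hq.symm.subset ⟨n, rfl⟩
  refine ⟨M, hM, fun C hC => ?_⟩
  obtain ⟨n, hn⟩ := hq.subset ⟨C, hC, rfl⟩
  exact ⟨n, Quotient.exact ((hn.symm).trans (hMq n).symm)⟩

theorem exists_isStar [Countable (Σ l, L.Functions l)] (hK : IsFraisseClass K)
    (hAP : StrictAP K) {A : Bundled.{w} L.Structure} (hA : A ∈ Kbar K) :
    ∃ D : Bundled.{w} L.Structure, IsStar K A D := by
  obtain ⟨M, hM, hMK⟩ := hK.exists_representatives
  have := hA.1
  have hMc : ∀ n, Countable (M n) := fun n => (hK.mem_Kbar (hM n)).1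
  have hBc : ∀ (B : {S : L.Substructure A // S.FG}) (n : ℕ), Countable (B.1 ↪[L] M n) :=
    fun B n => ((fg_iff_structure_fg _).1 B.2).countable_embedding _
  -- Countably many representatives `M n` suffice as targets, and a finitely generated `B` has only
  -- countably many embeddings into each of them; hence there are countably many pairs.
  let T := {t : Σ (B : {S : L.Substructure A // S.FG}) (n : ℕ), (sub B.1 ↪[L] M n) //
    sub t.1.1 ∈ K ∧ IsOnePointExt t.2.2}
  let r : Setoid T := 
    { r := fun t t' => ∃ (h : t.1.1.1 = t'.1.1.1) (ι : M t.1.2.1 ≃[L] M t'.1.2.1),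
        ∀ b : t.1.1.1, ι (t.1.2.2 b) = t'.1.2.2 (Substructure.inclusion h.le b)
      iseqv := by
        refine ⟨fun t => ⟨rfl, Language.Equiv.refl L _, fun b => rfl⟩, ?_, ?_⟩
        · rintro t t' ⟨h, ι, hι⟩
          refine ⟨h.symm, ι.symm, fun b => ι.injective ?_⟩
          rw [Language.Equiv.apply_symm_apply, hι]
          rfl
        · rintro t t' t'' ⟨h, ι, hι⟩ ⟨h', ι', hι'⟩
          refine ⟨h.trans h', ι'.comp ι, fun b => ?_⟩
          rw [Language.Equiv.comp_apply, hι, hι']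
          rfl }
  let Q := Quotient r
  -- The index type of a multi-amalgam lives in `Type`; countability allows shrinking the quotient
  -- to it.
  have : Small.{0} Q := Countable.toSmall Q
  let rep : Shrink.{0} Q → T := fun i => ((equivShrink Q).symm i).out
  let S : RootedMultiAmalgam K A :=
    { I := Shrink.{0} Q
      B := fun i => (rep i).1.1.1
      C := fun i => M (rep i).1.2.1
      emb := fun i => (rep i).1.2.2
      fg := fun i => (rep i).1.1.2
      B_mem := fun i => (rep i).2.1
      C_mem := fun i => hM _ }
  have : Countable S.I := (equivShrink Q).symm.injective.countable
  refine ⟨_, S, ⟨fun i => (rep i).2.2, fun B hB hBK C hC e he => ?_⟩,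
    (S.exists_isFreeSum hK hAP hA).choose_spec⟩
  obtain ⟨n, ⟨θ⟩⟩ := hMK C hC
  let t : T := ⟨⟨⟨B, hB⟩, n, θ.toEmbedding.comp e⟩, hBK, he.of_equiv θ (Set.range_comp θ e)⟩
  have key : ∀ i, (∃ (h : S.B i = B) (ι : S.C i ≃[L] C),
      ∀ b : S.B i, ι (S.emb i b) = e (Substructure.inclusion h.le b)) ↔ rep i ≈ t := by
    refine fun i => ⟨?_, ?_⟩
    · rintro ⟨h, ι, hι⟩
      exact ⟨h, θ.comp ι, fun b => congrArg θ (hι b)⟩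
    · rintro ⟨h, ι, hι⟩
      refine ⟨h, θ.symm.comp ι, fun b => θ.injective ?_⟩
      rw [Language.Equiv.comp_apply, Language.Equiv.apply_symm_apply]
      exact hι b
  simp only [key]
  have hrep : ∀ i, rep i ≈ t ↔ i = equivShrink Q ⟦t⟧ := fun i =>
    (Quotient.eq (r := r)).symm.trans <| by
      rw [Quotient.out_eq, _root_.Equiv.symm_apply_eq]
  exact ⟨_, (hrep _).2 rfl, fun i => (hrep i).1⟩

end Star

/-! ### Invariance and pasting of pushout squares. -/

section PushoutSquares

variable {K : Set (Bundled.{w} L.Structure)}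

theorem IsPushoutSquare.exists_equiv {X Y Z P X' Y' Z' P' : Bundled.{w} L.Structure}
    {f : X →[L] Y} {g : X →[L] Z} {i₁ : Y →[L] P} {i₂ : Z →[L] P}
    (h : IsPushoutSquare K f g i₁ i₂)
    {f' : X' →[L] Y'} {g' : X' →[L] Z'} {i₁' : Y' →[L] P'} {i₂' : Z' →[L] P'}
    (h' : IsPushoutSquare K f' g' i₁' i₂') (θX : X ≃[L] X') (θY : Y ≃[L] Y') (θZ : Z ≃[L] Z')
    (hf : ∀ x, θY (f x) = f' (θX x)) (hg : ∀ x, θZ (g x) = g' (θX x)) :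
    ∃ θ : P ≃[L] P', (∀ y, θ (i₁ y) = i₁' (θY y)) ∧ ∀ z, θ (i₂ z) = i₂' (θZ z) := by
  obtain ⟨s, hs₁, hs₂⟩ := h.exists_hom h'.mem_Kbar (i₁'.comp θY.toHom) (i₂'.comp θZ.toHom)
    fun x => by
      change i₁' (θY _) = i₂' (θZ _)
      rw [hf, hg, h'.comm_apply]
  change ∀ y, s (i₁ y) = i₁' (θY y) at hs₁
  change ∀ z, s (i₂ z) = i₂' (θZ z) at hs₂
  obtain ⟨t, ht₁, ht₂⟩ := h'.exists_hom h.mem_Kbar (i₁.comp θY.symm.toHom) (i₂.comp θZ.symm.toHom)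
    fun x => by
      change i₁ (θY.symm _) = i₂ (θZ.symm _)
      rw [← θX.apply_symm_apply x, ← hf, ← hg, θY.symm_apply_apply, θZ.symm_apply_apply,
        h.comm_apply]
  change ∀ y, t (i₁' y) = i₁ (θY.symm y) at ht₁
  change ∀ z, t (i₂' z) = i₂ (θZ.symm z) at ht₂
  have hts : t.comp s = Hom.id L P := h.hom_ext h.mem_Kbar
    (fun y => by simp [hs₁, ht₁]) fun z => by simp [hs₂, ht₂]
  have hst : s.comp t = Hom.id L P' := h'.hom_ext h'.mem_Kbar
    (fun y => by simp [hs₁, ht₁]) fun z => by simp [hs₂, ht₂]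
  obtain ⟨θ, hθ⟩ := exists_equiv_of_inverse s t (DFunLike.congr_fun hst) (DFunLike.congr_fun hts)
  exact ⟨θ, fun y => by rw [hθ, hs₁], fun z => by rw [hθ, hs₂]⟩

theorem IsPushoutSquare.of_equiv_span {X Y Z P X' Y' : Bundled.{w} L.Structure}
    {f : X →[L] Y} {g : X →[L] Z} {i₁ : Y →[L] P} {i₂ : Z →[L] P}
    (h : IsPushoutSquare K f g i₁ i₂) (θX : X' ≃[L] X) (θY : Y' ≃[L] Y) {f' : X' →[L] Y'}
    (hf : ∀ x, θY (f' x) = f (θX x)) :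
    IsPushoutSquare K f' (g.comp θX.toHom) (i₁.comp θY.toHom) i₂ := by
  refine isPushoutSquare_of h.mem_Kbar (fun x => ?_) (fun Q hQ j₁ j₂ hj => ?_)
    fun Q hQ t t' h₁ h₂ => h.hom_ext hQ (fun y => ?_) h₂
  · exact (congrArg i₁ (hf x)).trans (h.comm_apply _)
  · obtain ⟨t, ht₁, ht₂⟩ := h.exists_hom hQ (j₁.comp θY.symm.toHom) j₂ fun x => by
      rw [← θX.apply_symm_apply x, ← hf]
      exact (congrArg j₁ (θY.symm_apply_apply _)).trans (hj _)
    exact ⟨t, fun y => (ht₁ _).trans (congrArg j₁ (θY.symm_apply_apply y)), ht₂⟩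
  · rw [← θY.apply_symm_apply y]
    exact h₁ _

theorem IsPushoutSquare.paste {X X' X'' Y P Q : Bundled.{w} L.Structure}
    {e : X →[L] Y} {g : X →[L] X'} {g' : X' →[L] X''} {f : Y →[L] P} {i : X' →[L] P}
    {f' : P →[L] Q} {i' : X'' →[L] Q} (h : IsPushoutSquare K e g f i)
    (h' : IsPushoutSquare K i g' f' i') :
    IsPushoutSquare K e (g'.comp g) (f'.comp f) i' := by
  refine isPushoutSquare_of h'.mem_Kbar (fun x => ?_) (fun R hR j₁ j₂ hj => ?_)
    fun R hR t t' h₁ h₂ => ?_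
  · exact (congrArg f' (h.comm_apply x)).trans (h'.comm_apply _)
  · obtain ⟨t, ht₁, ht₂⟩ := h.exists_hom hR j₁ (j₂.comp g') hj
    obtain ⟨t', ht₁', ht₂'⟩ := h'.exists_hom hR t j₂ ht₂
    exact ⟨t', fun y => (ht₁' _).trans (ht₁ y), ht₂'⟩
  · have : t.comp f' = t'.comp f' := h.hom_ext hR h₁ fun z => by
      have := h₂ (g' z)
      rwa [← h'.comm_apply] at this
    exact h'.hom_ext hR (DFunLike.congr_fun this) h₂

theorem isPushoutSquare_of_surjective {X Y Z : Bundled.{w} L.Structure} (hZ : Z ∈ Kbar K)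
    {e : X →[L] Y} {g : X →[L] Z} {f : Y →[L] Z} (he : Function.Surjective e)
    (hf : ∀ x, f (e x) = g x) : IsPushoutSquare K e g f (Hom.id L Z) := by
  refine isPushoutSquare_of hZ hf (fun Q hQ j₁ j₂ hj => ⟨j₂, fun y => ?_, fun z => rfl⟩)
    fun Q hQ t t' h₁ h₂ => DFunLike.ext _ _ h₂
  obtain ⟨x, rfl⟩ := he y
  rw [hf, hj]

theorem isPushoutSquare_id {X Y : Bundled.{w} L.Structure} (hY : Y ∈ Kbar K) (e : X →[L] Y) :
    IsPushoutSquare K e (Hom.id L X) (Hom.id L Y) e :=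
  isPushoutSquare_of hY (fun _ => rfl)
    (fun _ _ j₁ _ hj => ⟨j₁, fun _ => rfl, hj⟩) fun _ _ _ _ h₁ _ => DFunLike.ext _ _ h₁

end PushoutSquares

/-! ### Extending endomorphisms of A to A⋆. -/

section Endomorphisms

variable {K : Set (Bundled.{w} L.Structure)}

/-- An extension by at most one point. -/
def IsSmallExt {B C : Bundled.{w} L.Structure} (e : B ↪[L] C) : Prop :=
  Function.Surjective e ∨ IsOnePointExt e

/-- An automorphism over the base sends a generator to a generator, hence fixes the only one there
is. -/
theorem UniquelyGenerated.rigid (hU : UniquelyGenerated K) {B C : Bundled.{w} L.Structure}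
    (hB : B ∈ K) (hC : C ∈ K) {e : B ↪[L] C} (he : IsOnePointExt e) (ι : C ≃[L] C)
    (hι : ∀ b, ι (e b) = e b) (c : C) : ι c = c := by
  obtain ⟨x, hx⟩ := he
  have h1 : IsGenerator e (ι x) := hx.of_equiv ι <| by
    rw [← Set.range_comp]
    exact congrArg Set.range (funext fun b => (hι b).symm)
  have h2 : ι.toHom = Hom.id L C := Hom.eq_of_eqOn_dense hx.2 <| by
    rintro _ (⟨b, rfl⟩ | rfl)
    · exact hι b
    · exact hU B hB C hC e _ _ h1 hx
  exact DFunLike.congr_fun h2 c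

/-- Since `f'` is surjective, the image of the generator generates `P` over `B'`. It may fall into
`B'`, and then the extension collapses; this is why trivial extensions are allowed alongside
one-point ones. -/
theorem IsSmallExt.of_pushout (hP : StrictOnePHEP K) {B B' C P : Bundled.{w} L.Structure}
    (hB : B ∈ K) (hB' : B' ∈ K) (hC : C ∈ K) {i : B ↪[L] C} {f : B →[L] B'}
    (hi : IsOnePointExt i) (hf : Function.Surjective f) {f' : C →[L] P} {i' : B' ↪[L] P}
    (h : IsPushoutSquare K i.toHom f f' i'.toHom) : IsSmallExt i' := by
  have hf' := ((hP B hB B' hB' C hC i f hi hf).2 P f' i'.toHom h).2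
  obtain ⟨x, -, hx⟩ := hi
  have hgen : closure L (Set.range i' ∪ {f' x}) = ⊤ := by
    refine top_le_iff.1 ?_
    rw [← Hom.range_eq_top.2 hf', Hom.range_eq_map, ← hx, map_closure]
    refine closure_mono ?_
    rintro _ ⟨_, ⟨b, rfl⟩ | rfl, rfl⟩
    · exact Or.inl ⟨f b, (h.comm_apply b).symm⟩
    · exact Or.inr rfl
  by_cases hr : f' x ∈ Set.range i'
  · refine Or.inl fun y => ?_
    have : closure L (Set.range i' ∪ {f' x}) ≤ i'.toHom.range :=
      closure_le.2 (Set.union_subset (fun _ h => h) (Set.singleton_subset_iff.2 hr))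
    rw [hgen] at this
    exact this (mem_top y)
  · exact Or.inr ⟨_, hr, hgen⟩

variable {A D : Bundled.{w} L.Structure}

/-- The homomorphism `k` places the extension `e : X → P` of `b : X → A` in the free sum in the
canonical way: it extends `f ∘ b`, and agrees with `g j` whenever `e` is the extension `j`. -/
def IsCanonical (S : RootedMultiAmalgam K A) (f : A ↪[L] D) (g : ∀ i, S.C i ↪[L] D)
    {X P : Bundled.{w} L.Structure} (b : X ↪[L] A) (e : X ↪[L] P) (k : P →[L] D) : Prop :=
  (∀ x, k (e x) = f (b x)) ∧
    ∀ (j : S.I) (ι : S.C j ≃[L] P) (η : sub (S.B j) ≃[L] X),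
      (∀ z, b (η z) = (z : A)) → (∀ z, ι (S.emb j z) = e (η z)) → ∀ y, k (ι y) = g j y

variable {S : RootedMultiAmalgam K A} {f : A ↪[L] D} {g : ∀ i, S.C i ↪[L] D}

theorem RootedMultiAmalgam.IsComplete.exists_index (hS : S.IsComplete) (hK : IsFraisseClass K)
    {X P : Bundled.{w} L.Structure} (hX : X ∈ K) (hP : P ∈ K) (b : X ↪[L] A) {e : X ↪[L] P}
    (he : IsOnePointExt e) :
    ∃ (j : S.I) (ι : S.C j ≃[L] P) (η : sub (S.B j) ≃[L] X),
      (∀ z, b (η z) = (z : A)) ∧ ∀ z, ι (S.emb j z) = e (η z) := by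
  let θ := b.equivRange
  have hθ : ∀ z, b (θ.symm z) = z := fun z => by
    rw [← b.equivRange_apply]
    exact congrArg _ (θ.apply_symm_apply z)
  have hr : Set.range (e.comp θ.symm.toEmbedding) = Set.range e := by
    refine (Set.range_comp e θ.symm).trans ?_
    rw [(EquivLike.surjective θ.symm).range_eq, Set.image_univ]
  obtain ⟨j, ⟨h, ι, hι⟩, -⟩ := hS.existsUnique b.toHom.range ((hK.fg X hX).range _)
    (hK.iso_closed _ hX _ ⟨θ⟩) P hP (e.comp θ.symm.toEmbedding)
    (he.of_equiv (Language.Equiv.refl L P) (by rw [hr]; exact (Set.image_id _).symm))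
  obtain ⟨η, hη⟩ := exists_equiv_lift b (S.B j).subtype <| by
    rw [coe_subtype, Subtype.range_coe_subtype]
    exact congrArg SetLike.coe h
  refine ⟨j, ι, η, hη, fun z => (hι z).trans (congrArg e (b.injective ?_))⟩
  exact (hθ _).trans (hη z).symm

theorem RootedMultiAmalgam.IsComplete.index_unique (hS : S.IsComplete)
    {X P : Bundled.{w} L.Structure} {b : X ↪[L] A} {e : X ↪[L] P}
    {j : S.I} {ι : S.C j ≃[L] P} {η : sub (S.B j) ≃[L] X}
    (hη : ∀ z, b (η z) = (z : A)) (hι : ∀ z, ι (S.emb j z) = e (η z))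
    {j' : S.I} {ι' : S.C j' ≃[L] P} {η' : sub (S.B j') ≃[L] X}
    (hη' : ∀ z, b (η' z) = (z : A)) (hι' : ∀ z, ι' (S.emb j' z) = e (η' z)) : j' = j := by
  have h : S.B j' = S.B j := by
    ext a
    refine ⟨fun ha => ?_, fun ha => ?_⟩
    · have := hη' ⟨a, ha⟩
      rw [← η.apply_symm_apply (η' ⟨a, ha⟩), hη] at this
      exact (show _ = a from this) ▸ (η.symm (η' ⟨a, ha⟩)).2
    · have := hη ⟨a, ha⟩
      rw [← η'.apply_symm_apply (η ⟨a, ha⟩), hη'] at this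
      exact (show _ = a from this) ▸ (η'.symm (η ⟨a, ha⟩)).2
  refine (hS.existsUnique (S.B j) (S.fg j) (S.B_mem j) (S.C j) (S.C_mem j) (S.emb j)
    (hS.onePoint j)).unique ⟨h, ι.symm.comp ι', fun z => ι.injective ?_⟩
    ⟨rfl, Language.Equiv.refl L _, fun z => rfl⟩
  rw [Language.Equiv.comp_apply, ι.apply_symm_apply, hι', hι]
  exact congrArg e (b.injective ((hη' z).trans (hη (Substructure.inclusion h.le z)).symm))

/-- For a one-point extension, take `g j` through an isomorphism with the listed extension `j`. The
index is unique by completeness, and rigidity makes the isomorphism irrelevant. -/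
theorem exists_isCanonical (hK : IsFraisseClass K) (hU : UniquelyGenerated K) (hS : S.IsComplete)
    (hfg : ∀ i (z : S.B i), f z = g i (S.emb i z)) {X P : Bundled.{w} L.Structure} (hX : X ∈ K)
    (hP : P ∈ K) (b : X ↪[L] A) {e : X ↪[L] P} (he : IsSmallExt e) :
    ∃ k, IsCanonical S f g b e k := by
  rcases he with he | he
  · obtain ⟨θ, hθ⟩ := exists_equiv_of_bijective e he
    refine ⟨(f.comp (b.comp θ.symm.toEmbedding)).toHom, fun x => ?_, fun j ι η hη hι => ?_⟩
    · change f (b (θ.symm (e x))) = _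
      rw [← hθ, θ.symm_apply_apply]
    -- The listed extension is proper, so it cannot match the surjective `e`: the second clause is
    -- vacuous.
    · obtain ⟨x, hx, -⟩ := hS.onePoint j
      obtain ⟨y, hy⟩ := he (ι x)
      refine (hx ⟨η.symm y, ι.injective ?_⟩).elim
      rw [hι, η.apply_symm_apply, hy]
  · obtain ⟨j, ι, η, hη, hι⟩ := hS.exists_index hK hX hP b he
    refine ⟨(g j).toHom.comp ι.symm.toHom, fun x => ?_, fun j' ι' η' hη' hι' y => ?_⟩
    · change g j (ι.symm (e x)) = _
      rw [← η.apply_symm_apply x, ← hι, ι.symm_apply_apply, ← hfg, hη]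
    · obtain rfl := hS.index_unique hη hι hη' hι'
      refine congrArg (g j') ?_
      refine hU.rigid (S.B_mem j') (S.C_mem j') (hS.onePoint j') (ι.symm.comp ι') (fun z => ?_) y
      rw [Language.Equiv.comp_apply, hι', ← ι.symm_apply_apply (S.emb j' z), hι]
      exact congrArg _ (congrArg e (b.injective ((hη' z).trans (hη z).symm)))

theorem IsCanonical.unique (hK : IsFraisseClass K) (hS : S.IsComplete)
    {X P : Bundled.{w} L.Structure} (hX : X ∈ K) (hP : P ∈ K) {b : X ↪[L] A} {e : X ↪[L] P}
    (he : IsSmallExt e) {k k' : P →[L] D} (h : IsCanonical S f g b e k)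
    (h' : IsCanonical S f g b e k') : k = k' := by
  refine DFunLike.ext _ _ fun y => ?_
  rcases he with he | he
  · obtain ⟨x, rfl⟩ := he y
    rw [h.1, h'.1]
  · obtain ⟨j, ι, η, hη, hι⟩ := hS.exists_index hK hX hP b he
    rw [← ι.apply_symm_apply y, h.2 j ι η hη hι, h'.2 j ι η hη hι]

theorem isCanonical_emb (hK : IsFraisseClass K) (hU : UniquelyGenerated K) (hS : S.IsComplete)
    (hfg : ∀ i (z : S.B i), f z = g i (S.emb i z)) (i : S.I) :
    IsCanonical S f g (S.B i).subtype (S.emb i) (g i).toHom := by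
  obtain ⟨k, hk⟩ := exists_isCanonical (f := f) (g := g) hK hU hS hfg (S.B_mem i) (S.C_mem i)
    (S.B i).subtype (Or.inr (hS.onePoint i))
  have : k = (g i).toHom := DFunLike.ext _ _ fun y =>
    hk.2 i (Language.Equiv.refl L _) (Language.Equiv.refl L _) (fun _ => rfl) (fun _ => rfl) y
  exact this ▸ hk

theorem IsCanonical.of_equiv {X P X' P' : Bundled.{w} L.Structure} {b : X ↪[L] A} {e : X ↪[L] P}
    {b' : X' ↪[L] A} {e' : X' ↪[L] P'} {k' : P' →[L] D} (h : IsCanonical S f g b' e' k')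
    (σ : X ≃[L] X') (θ : P ≃[L] P') (hσ : ∀ x, b' (σ x) = b x) (hθ : ∀ x, θ (e x) = e' (σ x)) :
    IsCanonical S f g b e (k'.comp θ.toHom) := by
  refine ⟨fun x => ?_, fun j ι η hη hι y => ?_⟩
  · change k' (θ (e x)) = _
    rw [hθ, h.1, hσ]
  · refine h.2 j (θ.comp ι) (σ.comp η) (fun z => ?_) (fun z => ?_) y
    · rw [Language.Equiv.comp_apply, hσ, hη]
    · rw [Language.Equiv.comp_apply, Language.Equiv.comp_apply, hι, hθ]

/-- The homomorphism `m` on the extension `e : X → C` of `b : X → A` is the pushout of `e` along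
`φ`, followed by the canonical homomorphism into the free sum. -/
def IsTransport (S : RootedMultiAmalgam K A) (f : A ↪[L] D) (g : ∀ i, S.C i ↪[L] D)
    (φ : A →[L] A) {X C : Bundled.{w} L.Structure} (b : X ↪[L] A) (e : X ↪[L] C)
    (m : C →[L] D) : Prop :=
  ∃ X' ∈ K, ∃ (h : X →[L] X') (b' : X' ↪[L] A), Function.Surjective h ∧
    (∀ x, b' (h x) = φ (b x)) ∧
    ∃ P ∈ K, ∃ (f' : C →[L] P) (i' : X' ↪[L] P), IsPushoutSquare K e.toHom h f' i'.toHom ∧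
      IsSmallExt i' ∧ ∃ k' : P →[L] D, IsCanonical S f g b' i' k' ∧ ∀ c, m c = k' (f' c)

theorem IsTransport.apply {φ : A →[L] A} {X C : Bundled.{w} L.Structure} {b : X ↪[L] A}
    {e : X ↪[L] C} {m : C →[L] D} (hm : IsTransport S f g φ b e m) (x : X) :
    m (e x) = f (φ (b x)) := by
  obtain ⟨X', -, h, b', -, hb', P, -, f', i', hpo, -, k', hk', hm⟩ := hm
  rw [hm, ← hb', ← hk'.1]
  exact congrArg k' (hpo.comm_apply x)

theorem exists_surjective_factorization (hK : IsFraisseClass K) (hA : A ∈ Kbar K)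
    {X : Bundled.{w} L.Structure} (hX : X ∈ K) (b : X ↪[L] A) (φ : A →[L] A) :
    ∃ X' ∈ K, ∃ (h : X →[L] X') (b' : X' ↪[L] A), Function.Surjective h ∧
      ∀ x, b' (h x) = φ (b x) := by
  let R := (φ.comp b.toHom).range
  obtain ⟨h, hh⟩ := exists_hom_lift R.subtype (φ.comp b.toHom) fun x => ⟨⟨_, x, rfl⟩, rfl⟩
  have hsurj : Function.Surjective h := by
    rintro ⟨_, x, rfl⟩
    exact ⟨x, Subtype.ext (hh x)⟩
  refine ⟨sub R, ?_, h, R.subtype, hsurj, hh⟩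
  cases isEmpty_or_nonempty X with
  | inl hX' =>
    have : IsEmpty (sub R) := hsurj.isEmpty
    obtain ⟨t, -⟩ := exists_embedding_lift (Y := sub R) R.subtype b fun x => isEmptyElim x
    exact hK.mem_of_surjective hX t fun y => isEmptyElim y
  | inr hX' => exact hA.2.1 R ((hK.fg X hX).range _) (hX'.map h)

theorem exists_isTransport [Countable (Σ l, L.Functions l)] (hK : IsFraisseClass K)
    (hU : UniquelyGenerated K) (hPH : StrictOnePHEP K) (hA : A ∈ Kbar K) (hS : S.IsComplete)
    (hfg : ∀ i (z : S.B i), f z = g i (S.emb i z)) (φ : A →[L] A)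
    {X C : Bundled.{w} L.Structure} (hX : X ∈ K) (hC : C ∈ K) (b : X ↪[L] A) {e : X ↪[L] C}
    (he : IsSmallExt e) : ∃ m, IsTransport S f g φ b e m := by
  obtain ⟨X', hX', h, b', hh, hb'⟩ := exists_surjective_factorization hK hA hX b φ
  suffices H : ∃ P ∈ K, ∃ (f' : C →[L] P) (i' : X' ↪[L] P),
      IsPushoutSquare K e.toHom h f' i'.toHom ∧ IsSmallExt i' by
    obtain ⟨P, hP, f', i', hpo, hi'⟩ := H
    obtain ⟨k', hk'⟩ := exists_isCanonical (f := f) (g := g) hK hU hS hfg hX' hP b' hi'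
    exact ⟨k'.comp f', X', hX', h, b', hh, hb', P, hP, f', i', hpo, hi', k', hk', fun _ => rfl⟩
  rcases he with he | he
  · obtain ⟨θ, hθ⟩ := exists_equiv_of_bijective e he
    refine ⟨X', hX', h.comp θ.symm.toHom, Embedding.refl L X',
      isPushoutSquare_of_surjective (hK.mem_Kbar hX') he fun x => ?_, Or.inl fun y => ⟨y, rfl⟩⟩
    change h (θ.symm (e x)) = _
    rw [← hθ, θ.symm_apply_apply]
  · obtain ⟨⟨P, hP, f', i', hpo⟩, hall⟩ := hPH X hX X' hX' C hC e h he hh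
    obtain ⟨⟨i'', rfl⟩, -⟩ := hall P f' i' hpo
    exact ⟨P, hP, f', i'', hpo, IsSmallExt.of_pushout hPH hX hX' hC he hh hpo⟩

/-- The two images of `X` under `φ ∘ b` coincide in `A`, which gives an isomorphism `σ`; it induces
one between the pushouts, and canonical maps respect it. -/
theorem IsTransport.unique (hK : IsFraisseClass K) (hS : S.IsComplete) {φ : A →[L] A}
    {X C : Bundled.{w} L.Structure} {b : X ↪[L] A} {e : X ↪[L] C} {m₁ m₂ : C →[L] D}
    (h₁ : IsTransport S f g φ b e m₁) (h₂ : IsTransport S f g φ b e m₂) : m₁ = m₂ := by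
  obtain ⟨X₁, hX₁, h₁, b₁, hh₁, hb₁, P₁, hP₁, f₁, i₁, hpo₁, hi₁, k₁, hk₁, hm₁⟩ := h₁
  obtain ⟨X₂, hX₂, h₂, b₂, hh₂, hb₂, P₂, hP₂, f₂, i₂, hpo₂, hi₂, k₂, hk₂, hm₂⟩ := h₂
  obtain ⟨σ, hσ⟩ := exists_equiv_lift b₂ b₁ <| by
    rw [← hh₁.range_comp b₁, ← hh₂.range_comp b₂]
    exact congrArg Set.range (funext fun x => (hb₁ x).trans (hb₂ x).symm)
  obtain ⟨θ, hθf, hθi⟩ := hpo₁.exists_equiv hpo₂ (Language.Equiv.refl L X)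
    (Language.Equiv.refl L C) σ (fun _ => rfl)
    fun x => b₂.injective ((hσ _).trans ((hb₁ x).trans (hb₂ x).symm))
  have := hk₁.unique hK hS hX₁ hP₁ hi₁ (hk₂.of_equiv σ θ hσ hθi)
  refine DFunLike.ext _ _ fun c => ?_
  rw [hm₁, hm₂, this]
  exact congrArg k₂ (hθf c)

theorem IsTransport.of_equiv {φ : A →[L] A} {X C X' C' : Bundled.{w} L.Structure} {b : X ↪[L] A}
    {e : X ↪[L] C} {b' : X' ↪[L] A} {e' : X' ↪[L] C'} {m : C →[L] D}
    (h : IsTransport S f g φ b e m) (η : X' ≃[L] X) (ι : C' ≃[L] C) (hη : ∀ x, b (η x) = b' x)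
    (hι : ∀ x, ι (e' x) = e (η x)) : IsTransport S f g φ b' e' (m.comp ι.toHom) := by
  obtain ⟨Y, hY, h, c, hh, hc, P, hP, f', i', hpo, hi', k', hk', hm⟩ := h
  exact ⟨Y, hY, h.comp η.toHom, c, hh.comp (EquivLike.surjective η),
    fun x => (hc _).trans (congrArg φ (hη x)), P, hP, f'.comp ι.toHom, i',
    hpo.of_equiv_span η ι hι, hi', k', hk', fun y => hm _⟩

/-- The endomorphism `δ` of the free sum extends `φ`, and transports all extensions along `φ`. -/
structure IsStarMap (S : RootedMultiAmalgam K A) (f : A ↪[L] D) (g : ∀ i, S.C i ↪[L] D)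
    (φ : A →[L] A) (δ : D →[L] D) : Prop where
  apply : ∀ a, δ (f a) = f (φ a)
  transport : ∀ X ∈ K, ∀ C ∈ K, ∀ (b : X ↪[L] A) (e : X ↪[L] C), IsSmallExt e →
    ∀ k, IsCanonical S f g b e k → IsTransport S f g φ b e (δ.comp k)

theorem exists_isStarMap [Countable (Σ l, L.Functions l)] (hK : IsFraisseClass K)
    (hU : UniquelyGenerated K) (hPH : StrictOnePHEP K) (hA : A ∈ Kbar K) (hS : S.IsComplete)
    (hD : IsFreeSum S f g) (φ : A →[L] A) : ∃ δ, IsStarMap S f g φ δ := by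
  -- Transport is prescribed only on the listed extensions; the remaining small ones reduce to these
  -- by isomorphism, or to `A` when trivial.
  choose ψ hψ using fun i => exists_isTransport hK hU hPH hA hS hD.comm φ (S.B_mem i) (S.C_mem i)
    (S.B i).subtype (Or.inr (hS.onePoint i))
  obtain ⟨δ, ⟨hδf, hδg⟩, -⟩ := hD.universal D hD.mem_Kbar (f.toHom.comp φ) ψ
    fun i z => ((hψ i).apply z).symm
  have hδ : ∀ a, δ (f a) = f (φ a) := DFunLike.congr_fun hδf
  refine ⟨δ, hδ, fun X hX C hC b e he k hk => ?_⟩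
  obtain ⟨m, hm⟩ := exists_isTransport hK hU hPH hA hS hD.comm φ hX hC b he
  suffices H : m = δ.comp k from H ▸ hm
  refine DFunLike.ext _ _ fun y => ?_
  rcases he with he | he
  · obtain ⟨x, rfl⟩ := he y
    rw [hm.apply, Hom.comp_apply, hk.1, hδ]
  · obtain ⟨j, ι, η, hη, hι⟩ := hS.exists_index hK hX hC b he
    have h1 := (hm.of_equiv (b' := (S.B j).subtype) η ι hη hι).unique hK hS (hψ j)
    have h2 := DFunLike.congr_fun (h1.trans (hδg j).symm) (ι.symm y)
    change m (ι (ι.symm y)) = δ (g j (ι.symm y)) at h2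
    rwa [← hk.2 j ι η hη hι, ι.apply_symm_apply] at h2

theorem IsStarMap.unique (hK : IsFraisseClass K) (hU : UniquelyGenerated K) (hS : S.IsComplete)
    (hD : IsFreeSum S f g) {φ : A →[L] A} {δ δ' : D →[L] D} (h : IsStarMap S f g φ δ)
    (h' : IsStarMap S f g φ δ') : δ = δ' := by
  have hf : δ.comp f.toHom = δ'.comp f.toHom :=
    DFunLike.ext _ _ fun a => (h.apply a).trans (h'.apply a).symm
  have hg : ∀ i, δ.comp (g i).toHom = δ'.comp (g i).toHom := fun i =>
    have hc := isCanonical_emb hK hU hS hD.comm i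
    have hs : IsSmallExt (S.emb i) := Or.inr (hS.onePoint i)
    (h.transport _ (S.B_mem i) _ (S.C_mem i) _ _ hs _ hc).unique hK hS
      (h'.transport _ (S.B_mem i) _ (S.C_mem i) _ _ hs _ hc)
  refine (hD.universal D hD.mem_Kbar (δ'.comp f.toHom) (fun i => δ'.comp (g i).toHom) ?_).unique
    ⟨hf, hg⟩ ⟨rfl, fun _ => rfl⟩
  exact fun i z => congrArg δ' (hD.comm i z)

theorem isStarMap_id [Countable (Σ l, L.Functions l)] (hK : IsFraisseClass K) :
    IsStarMap S f g (Hom.id L A) (Hom.id L D) :=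
  ⟨fun _ => rfl, fun X hX C hC b e he k hk => ⟨X, hX, Hom.id L X, b, fun x => ⟨x, rfl⟩,
    fun _ => rfl, C, hC, Hom.id L C, e, isPushoutSquare_id (hK.mem_Kbar hC) _, he, k, hk,
    fun _ => rfl⟩⟩

/-- Pushing out along `ψ` and then along `φ` is pushing out along `φ ∘ ψ`, by pasting. The middle
extension may be trivial, so transport is required for all small extensions and not just the listed
ones. -/
theorem IsStarMap.comp {φ ψ : A →[L] A} {δ ε : D →[L] D} (hδ : IsStarMap S f g φ δ)
    (hε : IsStarMap S f g ψ ε) : IsStarMap S f g (φ.comp ψ) (δ.comp ε) := by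
  refine ⟨fun a => ?_, fun X hX C hC b e he k hk => ?_⟩
  · rw [Hom.comp_apply, hε.apply, hδ.apply, Hom.comp_apply]
  · obtain ⟨X', hX', h, b', hh, hb', P, hP, f', i', hpo, hi', k', hk', hm⟩ :=
      hε.transport X hX C hC b e he k hk
    obtain ⟨X'', hX'', h', b'', hh', hb'', P', hP', f'', i'', hpo', hi'', k'', hk'', hm'⟩ :=
      hδ.transport X' hX' P hP b' i' hi' k' hk'
    refine ⟨X'', hX'', h'.comp h, b'', hh'.comp hh, fun x => ?_, P', hP', f''.comp f', i'',
      hpo.paste hpo', hi'', k'', hk'', fun c => ?_⟩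
    · exact (hb'' _).trans (congrArg φ (hb' x))
    · exact (congrArg δ (hm c)).trans (hm' _)

theorem exists_monoidHom_star [Countable (Σ l, L.Functions l)] (hK : IsFraisseClass K)
    (hU : UniquelyGenerated K) (hPH : StrictOnePHEP K) (hA : A ∈ Kbar K) (hS : S.IsComplete)
    (hD : IsFreeSum S f g) :
    ∃ Θ : (A →[L] A) →* (D →[L] D), ∀ φ a, Θ φ (f a) = f (φ a) := by
  choose Θ hΘ using exists_isStarMap hK hU hPH hA hS hD
  exact ⟨⟨⟨Θ, (hΘ _).unique hK hU hS hD (isStarMap_id hK)⟩, fun φ ψ =>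
    (hΘ _).unique hK hU hS hD ((hΘ φ).comp (hΘ ψ))⟩, fun φ => (hΘ φ).apply⟩

theorem injective_of_apply_eq {A D : Type*} [L.Structure A] [L.Structure D] (f : A ↪[L] D)
    {Θ : (A →[L] A) → (D →[L] D)} (h : ∀ φ a, Θ φ (f a) = f (φ a)) : Function.Injective Θ :=
  fun φ ψ hφψ => DFunLike.ext _ _ fun a => f.injective <| by rw [← h, hφψ, h]

theorem IsStar.monoidEmbeds [Countable (Σ l, L.Functions l)] (hK : IsFraisseClass K)
    (hU : UniquelyGenerated K) (hPH : StrictOnePHEP K) (hA : A ∈ Kbar K) (hD : IsStar K A D) :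
    MonoidEmbeds (A →[L] A) (D →[L] D) := by
  obtain ⟨S, hS, f, g, hD⟩ := hD
  obtain ⟨Θ, hΘ⟩ := exists_monoidHom_star hK hU hPH hA hS hD
  exact ⟨Θ, injective_of_apply_eq f hΘ⟩

end Endomorphisms

/-! ### Fraïssé limits as unions of iterated extensions. -/

section Limits

variable {K : Set (Bundled.{w} L.Structure)}

/-- Every one-point extension in `K` of a substructure of `G` in `K` is realized in `G`. -/
def RealizesOnePointExts (K : Set (Bundled.{w} L.Structure)) (G : Bundled.{w} L.Structure) : Prop :=
  ∀ X ∈ K, ∀ C ∈ K, ∀ (b : X ↪[L] G) (e : X ↪[L] C), IsOnePointExt e →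
    ∃ k : C ↪[L] G, ∀ x, k (e x) = b x

theorem isOnePointExt_inclusion {M : Bundled.{w} L.Structure} {N N' : L.Substructure M} {a : M}
    (hN : N ≤ N') (hN' : N' = N ⊔ closure L {a}) (ha : a ∉ N) :
    IsOnePointExt (B := sub N) (C := sub N') (Substructure.inclusion hN) := by
  have haN' : a ∈ N' := hN' ▸ (le_sup_right : closure L {a} ≤ _) (subset_closure rfl)
  refine ⟨⟨a, haN'⟩, ?_, ?_⟩
  · rintro ⟨x, hx⟩
    exact ha ((show (x : M) = a from congrArg Subtype.val hx) ▸ x.2)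
  · refine map_injective_of_injective (f := N'.subtype.toHom) N'.subtype_injective ?_
    rw [map_closure, ← Hom.range_eq_map, range_subtype, Set.image_union, Substructure.closure_union,
      Set.image_singleton, ← Set.range_comp]
    conv_rhs => rw [hN']
    congr 1
    have : Set.range (N'.subtype.toHom ∘ Substructure.inclusion hN) = (N : Set M) :=
      Subtype.range_coe
    exact (congrArg _ this).trans (closure_eq N)

theorem RealizesOnePointExts.exists_extension_sup {G : Bundled.{w} L.Structure}
    (hG : RealizesOnePointExts K G) [Countable (Σ l, L.Functions l)] (hK : IsFraisseClass K)
    {E Q : Bundled.{w} L.Structure} (hE : E ∈ K) (hQ : Q ∈ K) (e : E ↪[L] Q) (b : E ↪[L] G)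
    {N : L.Substructure Q} (hN : N.FG) (heN : ∀ x, e x ∈ N) (k : sub N ↪[L] G)
    (hk : ∀ x, k ⟨e x, heN x⟩ = b x) (a : Q) :
    ∃ k : sub (N ⊔ closure L {a}) ↪[L] G,
      ∀ x (hx : e x ∈ N ⊔ closure L {a}), k ⟨e x, hx⟩ = b x := by
  by_cases ha : a ∈ N
  · have h : N ⊔ closure L {a} = N :=
      sup_eq_left.2 (closure_le.2 (Set.singleton_subset_iff.2 ha))
    rw [h]
    exact ⟨k, fun x _ => hk x⟩
  · have mem : ∀ {N' : L.Substructure Q}, N'.FG → (∀ x, e x ∈ N') → sub N' ∈ K :=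
      fun {N'} hfg h => by
        obtain ⟨t, -⟩ := exists_embedding_lift N'.subtype e fun x => ⟨⟨e x, h x⟩, rfl⟩
        exact hK.mem_of_between (N := sub N') hE t (hK.mem_Kbar hQ) N'.subtype
          ((fg_iff_structure_fg _).1 hfg)
    obtain ⟨k', hk'⟩ := hG (sub N) (mem hN heN) (sub (N ⊔ closure L {a}))
      (mem (hN.sup (fg_closure_singleton a)) fun x => (le_sup_left : N ≤ _) (heN x)) k
      (Substructure.inclusion le_sup_left) (isOnePointExt_inclusion le_sup_left rfl ha)
    exact ⟨k', fun x hx => (hk' ⟨e x, heN x⟩).trans (hk x)⟩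

/-- A finitely generated extension is a finite tower of steps that are trivial or one-point: add the
generators of `Q` one at a time. -/
theorem RealizesOnePointExts.exists_extension {G : Bundled.{w} L.Structure}
    (hG : RealizesOnePointExts K G) [Countable (Σ l, L.Functions l)] (hK : IsFraisseClass K)
    {E Q : Bundled.{w} L.Structure} (hE : E ∈ K) (hQ : Q ∈ K) (e : E ↪[L] Q) (b : E ↪[L] G) :
    ∃ k : Q ↪[L] G, ∀ x, k (e x) = b x := by
  classical
  have hEfg : e.toHom.range.FG := (hK.fg E hE).range _
  have key : ∀ s : Finset Q, ∃ k : sub (e.toHom.range ⊔ closure L (s : Set Q)) ↪[L] G,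
      ∀ x (hx : e x ∈ e.toHom.range ⊔ closure L (s : Set Q)), k ⟨e x, hx⟩ = b x := by
    intro s
    induction s using Finset.induction_on with
    | empty =>
      have h : e.toHom.range ⊔ closure L ((∅ : Finset Q) : Set Q) = e.toHom.range := by
        rw [Finset.coe_empty, Substructure.closure_empty, sup_bot_eq]
      rw [h]
      exact ⟨b.comp e.equivRange.symm.toEmbedding, fun x hx =>
        congrArg b (e.equivRange.symm_apply_apply x)⟩
    | insert a s _ ih =>
      obtain ⟨k, hk⟩ := ih
      have h : e.toHom.range ⊔ closure L ((insert a s : Finset Q) : Set Q) =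
          (e.toHom.range ⊔ closure L (s : Set Q)) ⊔ closure L {a} := by
        rw [Finset.coe_insert, Substructure.closure_insert, sup_assoc, sup_comm (closure L {a})]
      rw [h]
      exact hG.exists_extension_sup hK hE hQ e b (hEfg.sup (fg_closure s.finite_toSet))
        (fun x => (le_sup_left : e.toHom.range ≤ _) ⟨x, rfl⟩) k (fun x => hk x _) a
  obtain ⟨T, hT⟩ := (hK.fg Q hQ).out
  obtain ⟨k, hk⟩ := key T
  have hmem : ∀ y, y ∈ e.toHom.range ⊔ closure L (T : Set Q) := fun y => by
    rw [hT, sup_top_eq]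
    exact mem_top y
  obtain ⟨t, ht⟩ := exists_embedding_lift (e.toHom.range ⊔ closure L (T : Set Q)).subtype
    (Embedding.refl L Q) fun y => ⟨⟨y, hmem y⟩, rfl⟩
  refine ⟨k.comp t, fun x => ?_⟩
  rw [← hk x (hmem _)]
  exact congrArg k (Subtype.ext (ht _))

theorem RealizesOnePointExts.isLimit {G : Bundled.{w} L.Structure}
    (hG : RealizesOnePointExts K G) [Countable (Σ l, L.Functions l)] (hK : IsFraisseClass K)
    (hGK : G ∈ Kbar K) : IsLimit K G := by
  have huniv : ∀ M ∈ K, Nonempty (M ↪[L] G) := fun M hM => by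
    obtain ⟨E, -, hE⟩ := exists_fg_mem hK hGK
    obtain ⟨Q, hQ, ⟨e⟩, ⟨m⟩⟩ := hK.jointEmbedding (sub E) hE M hM
    obtain ⟨k, -⟩ := hG.exists_extension hK hE hQ e E.subtype
    exact ⟨k.comp m⟩
  refine ⟨hGK, huniv, ?_⟩
  have : Countable G := hGK.1
  refine (isUltrahomogeneous_iff_IsExtensionPair Structure.cg_of_countable).2 <|
    isExtensionPair_iff_exists_embedding_closure_singleton_sup.2 fun S hS b m => ?_
  have hQ : sub (closure L {m} ⊔ S) ∈ K :=
    hGK.2.1 _ ((fg_closure_singleton m).sup hS)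
      ⟨⟨m, (le_sup_left : closure L {m} ≤ _) (subset_closure rfl)⟩⟩
  -- An empty `S` need not be in `K`, but then `b` imposes no condition and universality suffices.
  cases isEmpty_or_nonempty S with
  | inl h =>
    obtain ⟨k⟩ := huniv _ hQ
    exact ⟨k, DFunLike.ext _ _ fun x => isEmptyElim x⟩
  | inr h =>
    obtain ⟨k, hk⟩ := hG.exists_extension hK (hGK.2.1 S hS h) hQ
      (Substructure.inclusion le_sup_right) b
    exact ⟨k, DFunLike.ext _ _ fun x => (hk x).symm⟩

theorem IsLimit.age_subset (hK : IsFraisseClass K) {F F' : Bundled.{w} L.Structure}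
    (hF : IsLimit K F) (hF' : IsLimit K F') : L.age F ⊆ L.age F' := by
  rintro N ⟨hN, ⟨i⟩⟩
  refine ⟨hN, ?_⟩
  cases isEmpty_or_nonempty N with
  | inl h =>
    obtain ⟨M, hM⟩ := hK.nonempty
    obtain ⟨j⟩ := hF.universal M hM
    obtain ⟨j'⟩ := hF'.universal M hM
    obtain ⟨t, -⟩ := exists_embedding_lift j i fun x => isEmptyElim x
    exact ⟨j'.comp t⟩
  | inr h => exact hF'.universal N (hK.mem_of_mem_Kbar hF.mem_Kbar i hN)

/-- Uniqueness is applied to the age of `F` instead of `K`, as the two may differ in empty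
structures. -/
theorem IsLimit.nonempty_equiv [Countable (Σ l, L.Functions l)] (hK : IsFraisseClass K)
    {F F' : Bundled.{w} L.Structure} (hF : IsLimit K F) (hF' : IsLimit K F') :
    Nonempty (F ≃[L] F') := by
  have := hF.mem_Kbar.1
  have := hF'.mem_Kbar.1
  exact IsFraisseLimit.nonempty_equiv (K := L.age F) ⟨hF.ultrahomogeneous, rfl⟩
    ⟨hF'.ultrahomogeneous, (hF'.age_subset hK hF).antisymm (hF.age_subset hK hF')⟩

theorem IsFreeSum.exists_onePointExt (hK : IsFraisseClass K) {A D : Bundled.{w} L.Structure}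
    {S : RootedMultiAmalgam K A} {f : A ↪[L] D} {g : ∀ i, S.C i ↪[L] D} (hS : S.IsComplete)
    (hD : IsFreeSum S f g) {X C : Bundled.{w} L.Structure} (hX : X ∈ K) (hC : C ∈ K)
    (b : X ↪[L] A) {e : X ↪[L] C} (he : IsOnePointExt e) :
    ∃ k : C ↪[L] D, ∀ x, k (e x) = f (b x) := by
  obtain ⟨j, ι, η, hη, hι⟩ := hS.exists_index hK hX hC b he
  refine ⟨(g j).comp ι.symm.toEmbedding, fun x => ?_⟩
  change g j (ι.symm (e x)) = _
  rw [← η.apply_symm_apply x, ← hι, ι.symm_apply_apply, ← hD.comm, hη]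

/-- The union of the chain of iterated extensions by all one-point extensions. -/
theorem exists_isLimit_monoidHom [Countable (Σ l, L.Functions l)] (hK : IsFraisseClass K)
    (hU : UniquelyGenerated K) (hAP : StrictAP K) (hPH : StrictOnePHEP K)
    {A : Bundled.{w} L.Structure} (hA : A ∈ Kbar K) :
    ∃ G : Bundled.{w} L.Structure, IsLimit K G ∧ ∃ (c : A ↪[L] G)
      (Θ : (A →[L] A) →* (G →[L] G)), ∀ φ a, Θ φ (c a) = c (φ a) := by
  obtain ⟨s, hs₀, hs⟩ := exists_seq_of_step
    (α := fun _ => {M : Bundled.{w} L.Structure // M ∈ Kbar K})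
    (fun _ M M' => ∃ (f : M.1 ↪[L] M'.1) (Θ : (M.1 →[L] M.1) →* (M'.1 →[L] M'.1)),
      (∀ φ a, Θ φ (f a) = f (φ a)) ∧
      ∀ X ∈ K, ∀ C ∈ K, ∀ (b : X ↪[L] M.1) (e : X ↪[L] C), IsOnePointExt e →
        ∃ k : C ↪[L] M'.1, ∀ x, k (e x) = f (b x))
    ⟨A, hA⟩ (fun _ M => by
      obtain ⟨D, S, hS, f, g, hD⟩ := exists_isStar hK hAP M.2
      obtain ⟨Θ, hΘ⟩ := exists_monoidHom_star hK hU hPH M.2 hS hD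
      exact ⟨⟨D, hD.mem_Kbar⟩, f, Θ, hΘ, fun X hX C hC b e he =>
        hD.exists_onePointExt hK hS hX hC b he⟩)
  have hA' : A = (s 0).1 := by rw [hs₀]
  clear hs₀
  subst hA'
  choose f Θ hΘ hext using hs
  obtain ⟨G, c, hc⟩ := exists_isChainUnion (G := fun n => (s n).1) f
  have hGK : G ∈ Kbar K := hc.mem_Kbar hK fun n => (s n).2
  -- The homomorphism from the endomorphisms of `A` to those of stage `n`. Its values on successive
  -- stages extend each other, so they glue to endomorphisms of the union.
  let Φ : ∀ n, ((s 0).1 →[L] (s 0).1) →* ((s n).1 →[L] (s n).1) := fun n =>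
    Nat.rec (MonoidHom.id _) (fun n Φ => (Θ n).comp Φ) n
  have hΦ : ∀ φ, ∃ t : G →[L] G, ∀ n x, t (c n x) = c n (Φ n φ x) := fun φ => by
    refine hc.exists_hom (fun n => (c n).toHom.comp (Φ n φ)) fun n x => ?_
    exact (congrArg (c (n + 1)) (hΘ n (Φ n φ) x)).trans (hc.comm n _)
  choose Ψ hΨ using hΦ
  refine ⟨G, RealizesOnePointExts.isLimit (fun X hX C hC b e he => ?_) hK hGK, c 0,
    ⟨⟨Ψ, hc.hom_ext fun n x => ?_⟩, fun φ ψ => hc.hom_ext fun n x => ?_⟩, fun φ a => hΨ φ 0 a⟩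
  -- The image of a finitely generated `X` lies in some stage, and the next stage realizes all its
  -- one-point extensions.
  · obtain ⟨n, hn⟩ := hc.exists_range_le ((hK.fg X hX).range b.toHom)
    obtain ⟨b', hb'⟩ := exists_embedding_lift (c n) b fun x => hn _ ⟨x, rfl⟩
    obtain ⟨k, hk⟩ := hext n X hX C hC b' e he
    exact ⟨(c (n + 1)).comp k, fun x =>
      (congrArg (c (n + 1)) (hk x)).trans ((hc.comm n _).trans (hb' x))⟩
  · rw [hΨ, map_one]
    rfl
  · rw [hΨ, map_mul]
    exact ((congrArg (Ψ φ) (hΨ ψ n x)).trans (hΨ φ n _)).symm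

theorem monoidEmbeds_of_equiv {A G F : Type*} [L.Structure A] [L.Structure G] [L.Structure F]
    (θ : G ≃[L] F) (c : A ↪[L] G) (Θ : (A →[L] A) →* (G →[L] G))
    (hΘ : ∀ φ a, Θ φ (c a) = c (φ a)) : MonoidEmbeds (A →[L] A) (F →[L] F) := by
  refine ⟨⟨⟨fun φ => (θ.toHom.comp (Θ φ)).comp θ.symm.toHom, DFunLike.ext _ _ fun y => ?_⟩,
    fun φ ψ => DFunLike.ext _ _ fun y => ?_⟩,
    injective_of_apply_eq (θ.toEmbedding.comp c) fun φ a => ?_⟩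
  · change θ (Θ 1 (θ.symm y)) = y
    rw [map_one]
    exact θ.apply_symm_apply y
  · change θ (Θ (φ * ψ) (θ.symm y)) = θ (Θ φ (θ.symm (θ (Θ ψ (θ.symm y)))))
    rw [map_mul, θ.symm_apply_apply]
    rfl
  · change θ (Θ φ (θ.symm (θ (c a)))) = θ (c (φ a))
    rw [θ.symm_apply_apply, hΘ]

end Limits

end FraisseEnd

theorem corollary2p2 {L : FirstOrder.Language.{u, v}} [Countable (Σ l, L.Functions l)]
    (K : Set (Bundled.{w} L.Structure)) :
    -- without operation symbols, one-point extensions are always uniquely generated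
    ((∀ n : ℕ, IsEmpty (L.Functions (n + 1))) → FraisseEnd.UniquelyGenerated K) ∧
    (FraisseEnd.IsFraisseClass K → FraisseEnd.UniquelyGenerated K →
      FraisseEnd.StrictAP K → FraisseEnd.StrictOnePHEP K →
        (∃ F : Bundled.{w} L.Structure, FraisseEnd.IsLimit K F) ∧
        ∀ A ∈ FraisseEnd.Kbar K,
          (∃ D : Bundled.{w} L.Structure, FraisseEnd.IsStar K A D) ∧
          (∀ D : Bundled.{w} L.Structure, FraisseEnd.IsStar K A D →
            FraisseEnd.MonoidEmbeds (A →[L] A) (D →[L] D)) ∧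
          (∀ F : Bundled.{w} L.Structure, FraisseEnd.IsLimit K F →
            FraisseEnd.MonoidEmbeds (A →[L] A) (F →[L] F))) := by
  refine ⟨FraisseEnd.uniquelyGenerated_of_isEmpty_functions K, fun hK hU hAP hPH => ⟨?_, ?_⟩⟩
  · obtain ⟨M, hM⟩ := hK.nonempty
    obtain ⟨G, hG, -⟩ := FraisseEnd.exists_isLimit_monoidHom hK hU hAP hPH (hK.mem_Kbar hM)
    exact ⟨G, hG⟩
  · refine fun A hA => ⟨FraisseEnd.exists_isStar hK hAP hA,
      fun D hD => hD.monoidEmbeds hK hU hPH hA, fun F hF => ?_⟩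
    obtain ⟨G, hG, c, Θ, hΘ⟩ := FraisseEnd.exists_isLimit_monoidHom hK hU hAP hPH hA
    obtain ⟨θ⟩ := hG.nonempty_equiv hK hF
    exact FraisseEnd.monoidEmbeds_of_equiv θ c Θ hΘ
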